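/- **Setting.** Agents $1,\dots,n$ minimise $f=\frac1n\sum_{i=1}^n f_i$ over $\mathbb R^d$ ($d\ge1$), where each $f_i:\mathbb R^d\to\mathbb R$ is differentiable with $\|\nabla f_i(x)-\nabla f_i(y)\|\le \ell\|x-y\|$ for all $x,y$ ($\ell>0$), $f^*=\inf f>-\infty$, and a number $f_{\rm low}\le f^*$ is known. The network is an undirected connected graph on the agents with symmetric weights $A_{ij}\ge 0$ and Laplacian $L=\mathrm{diag}(\sum_jA_{ij})-A$; let $\rho$ be the spectral radius and $\rho_2$ the smallest positive eigenvalue of $L$ (so $n\ge2$). For some $p\in[1,\infty]$, $r,C>0$, $\delta\in(0,1]$, the compressor $\mathcal C:\mathbb R^d\to\mathbb R^d$ satisfies $\|\mathcal C(x)/r-x\|_p\le C(1-\delta)$ whenever $\|x\|_p\le C$. Put $\hat d=d^{1/p-1/2},\ \tilde d=1$ if $p\le2$ and $\hat d=1,\ \tilde d=d^{1/2-1/p}$ if $p>2$. **Algorithm.** With parameters $\alpha,\beta,\gamma,\omega>0$ and $s_k>0$, starting from $x_{i,0}\in\mathbb R^d$, $v_{i,0}=0$, iterate for $k=0,1,\dots$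 $$q_{i,k}=\mathcal C\big((x_{i,k}-\hat x_{i,k-1})/s_k\big),\quad \hat x_{i,k}=\hat x_{i,k-1}+\omega s_kq_{i,k},\quad y_{i,k}=y_{i,k-1}+\omega s_k\sum_jL_{ij}q_{j,k},$$ $$x_{i,k+1}=x_{i,k}-\alpha(\beta y_{i,k}+\gamma v_{i,k}+\nabla f_i(x_{i,k})),\quad v_{i,k+1}=v_{i,k}+\alpha\gamma y_{i,k}.$$ The first communication round is uncompressed: either the agents exchange $x_{i,0}$ exactly beforehand, so that $\hat x_{i,-1}=x_{i,0}$ and $y_{i,-1}=\sum_jL_{ij}x_{j,0}$; or the exact exchange replaces the compressed one of iteration $0$, so that $\hat x_{i,0}=x_{i,0}$ and $y_{i,0}=\sum_jL_{ij}x_{j,0}$. Write $\bar x_k=\frac1n\sum_ix_{i,k}$. **Constants.** Put $\beta=\tau_1\gamma$, $\varepsilon_1=\frac{\tau_1\rho_2-1}{2\tau_1\rho_2}$, $\varepsilon_5=\omega r(\delta-\delta^2/2)$, $\varepsilon_8=(\varepsilon_5+2\varepsilon_5^2)/2$, and $$\varphi_1=\tfrac12(\rho_2\beta-3\gamma-2-2\ell^2),\quad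 \varphi_2=3\rho^2\beta^2-\rho_2\beta\gamma+(\rho+2)\gamma^2+1+\tfrac52\ell^2,\quad \varphi_3=\tfrac\gamma2-\tfrac{5}{2\rho_2},\quad \varphi_4=2\rho\gamma^2+\tfrac12\rho,$$ $$\varphi_5=\tfrac18-\tfrac{(\beta+\gamma)^2\ell^2}{\gamma^5\rho_2}-\tfrac{\ell^2}{2\gamma^2\rho_2^2},\quad \varphi_6=\tfrac{(\beta+\gamma)\ell^2}{2\gamma^3\rho_2}+\tfrac{\ell^2}{2\gamma^2\rho_2^2}+\tfrac{\ell^2}{2\rho_2^2}+\tfrac{\ell^2}2+\tfrac\ell2,$$ $$\varphi_7=(\rho+1)\gamma+\tfrac12\rho\beta,\quad \varphi_8=3\rho^2\beta^2+(\rho-2\rho_2)\beta\gamma+(\rho+2)\gamma^2+1,\quad \psi_2=\varphi_7+\alpha\varphi_8,$$ $$\psi_3=4(1+\varepsilon_5^{-1})\hat d^2\beta^2\rho^2,\quad \psi_4=4(1+\varepsilon_5^{-1})\hat d^2\max\{\beta^2\rho^2+\ell^2,\gamma^2\rho\}/\varepsilon_1,$$ $$\hat\kappa_0=\min\{\tfrac{\varphi_1}{\varphi_2},\tfrac{\varphi_3}{\varphi_4},\tfrac{\varphi_5}{\varphi_6}\},\quad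 \kappa_7=\min\{\hat\kappa_0,\tfrac1{2\ell}\},\quad \kappa_1=\tfrac4{\rho_2},\quad \kappa_2=\max\Big\{2+2\ell^2,\tfrac5{\rho_2},\sqrt[3]{\tfrac{16\ell^2(\kappa_1+1)^2}{\rho_2}},\tfrac{2\sqrt2\,\ell}{\rho_2}\Big\},$$ $$\kappa_0=\Big(\tfrac{\varepsilon_8}{2(1-2\varepsilon_5)\psi_2\psi_4}\Big)^{1/3}\ (=\infty\text{ if }\varepsilon_5=\tfrac12),\quad \kappa_3=\max\Big\{\tfrac{\tau_0^3}{n\tilde d^2\kappa_7^3},\Big(\tfrac{(1-2\varepsilon_5)\psi_3\tau_0^2}{\varepsilon_8}\Big)^{3/2}n^{1/2}\tilde d\Big\},$$ $$\kappa_4=\frac{2\psi_4\mathcal L_0}{C^2\varepsilon_8n},\qquad \tilde\kappa_4(T)=\psi_4\mathcal L_0\alpha^2/C^2+(1-2\varepsilon_5)\psi_2\psi_4n\tilde d^2s_0^2\alpha^3T.$$ Here $\mathcal L_0=\frac12\|\boldsymbol x_0\|_{\boldsymbol E}^2+\frac{\beta+\gamma}{2\gamma}\|\boldsymbol w_0\|_{\boldsymbol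 F}^2+\boldsymbol x_0^\top\boldsymbol E\boldsymbol F\boldsymbol w_0+n(f(\bar x_0)-f_{\rm low})$, where $\boldsymbol x_0$ stacks the $x_{i,0}$, $\boldsymbol w_0$ stacks the $\frac1\gamma\nabla f_i(\bar x_0)$, $\boldsymbol E=(I-\frac1n\mathbf 1\mathbf 1^\top)\otimes I_d$ and $\boldsymbol F=(L+\frac{\lambda}{n}\mathbf 1\mathbf 1^\top)^{-1}\otimes I_d$ for some fixed $\lambda\in[\rho_2,\rho]$. **Theorem.** Let $\tau_1\ge\kappa_1$, $\gamma>\kappa_2$, $\hat\kappa_0>0$, $\omega\in(0,1/r]$, $\tau_0,\tau_4>0$. There is a constant $M$, depending only on $\ell,\rho,\rho_2,\hat d,C,r,\delta,\gamma,\omega,\tau_0,\tau_1,\tau_4$ (in particular not on $n$, $\tilde d$, $T$), such that the following holds for all problems as above with these values. If $T>\kappa_3$ is an integer, $$\alpha=\frac{\tau_0}{n^{1/3}\tilde d^{2/3}T^{1/3}},\quad \beta=\tau_1\gamma,\quad s_0^2=\tau_4n\alpha^2,\quad s_k^2=(1-\varepsilon_8)s_{k-1}^2+\tilde\kappa_4(T)\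 (1\le k\le T),\quad \tau_0\le\kappa_0,\quad \tau_4\ge\kappa_4,$$ then the iterates of the algorithm with an uncompressed first round satisfy $$\frac1T\sum_{k=0}^{T-1}\Big(\|\nabla f(\bar x_k)\|^2+\frac1n\sum_{i=1}^n\|x_{i,k}-\bar x_k\|^2\Big)\le M\,\frac{n^{1/3}\tilde d^{2/3}}{T^{2/3}},\qquad f(\bar x_T)-f^*\le M .$$ -/

import Mathlib

open scoped Gradient InnerProductSpace ENNReal

noncomputable section

namespace CompressedOpt

/-- `ℝ^d` with its Euclidean norm. -/
abbrev Vec (d : ℕ) : Type := EuclideanSpace ℝ (Fin d)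

/-- The `ℓ_p` norm of a vector, `1 ≤ p ≤ ∞`. -/
def lpNorm (p : ℝ≥0∞) {d : ℕ} (x : Vec d) : ℝ := ‖WithLp.toLp p (WithLp.ofLp x)‖

/-- `d̂`, with `‖x‖_p ≤ d̂ ‖x‖₂` (here `1/∞ = 0`). -/
def dHat (p : ℝ≥0∞) (d : ℕ) : ℝ :=
  if p ≤ 2 then (d : ℝ) ^ ((p⁻¹).toReal - 1 / 2) else 1

/-- `d̃`, with `‖x‖₂ ≤ d̃ ‖x‖_p` (here `1/∞ = 0`). -/
def dTilde (p : ℝ≥0∞) (d : ℕ) : ℝ :=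
  if p ≤ 2 then 1 else (d : ℝ) ^ (1 / 2 - (p⁻¹).toReal)

/-- A locally-bounded compressor: on the `ℓ_p` ball of radius `C` the map `comp / r` deviates from
the identity by at most `C (1 - δ)` in the `ℓ_p` norm. -/
def LocallyBounded (p : ℝ≥0∞) {d : ℕ} (C r δ : ℝ) (comp : Vec d → Vec d) : Prop :=
  ∀ x : Vec d, lpNorm p x ≤ C → lpNorm p ((1 / r) • comp x - x) ≤ C * (1 - δ)

/-! ### The network -/

/-- `A` is the weighted adjacency matrix of an undirected connected graph on `Fin n`
(the edges are the pairs with a positive weight). -/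
structure IsConnectedNetwork {n : ℕ} (A : Matrix (Fin n) (Fin n) ℝ) : Prop where
  nonneg : ∀ i j, 0 ≤ A i j
  symm : ∀ i j, A i j = A j i
  connected : (SimpleGraph.fromRel (fun i j => 0 < A i j)).Connected

/-- The graph Laplacian `L = D - A`. -/
def laplacian {n : ℕ} (A : Matrix (Fin n) (Fin n) ℝ) : Matrix (Fin n) (Fin n) ℝ :=
  Matrix.diagonal (fun i => ∑ j, A i j) - A

/-- The averaging matrix `q qᵀ` with `q = 1/√n`. -/
def avgMatrix (n : ℕ) : Matrix (Fin n) (Fin n) ℝ := fun _ _ => 1 / (n : ℝ)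

/-- `E = I - q qᵀ`. -/
def matE (n : ℕ) : Matrix (Fin n) (Fin n) ℝ := 1 - avgMatrix n

/-- `F = [q Q] diag(lam⁻¹, Λ⁻¹) [q Q]ᵀ`, where `L = [q Q] diag(0, Λ) [q Q]ᵀ`; equivalently, the
inverse of `L + lam q qᵀ = [q Q] diag(lam, Λ) [q Q]ᵀ`. -/
def matF {n : ℕ} (A : Matrix (Fin n) (Fin n) ℝ) (lam : ℝ) : Matrix (Fin n) (Fin n) ℝ :=
  (laplacian A + lam • avgMatrix n)⁻¹

/-- `uᵀ (M ⊗ I_d) w` for stacked vectors `u`, `w`. -/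
def bilin {n d : ℕ} (M : Matrix (Fin n) (Fin n) ℝ) (u w : Fin n → Vec d) : ℝ :=
  ∑ i, ∑ j, M i j * ⟪u i, w j⟫_ℝ

/-- `(M ⊗ I_d) u` for a stacked vector `u`. -/
def applyMat {n d : ℕ} (M : Matrix (Fin n) (Fin n) ℝ) (u : Fin n → Vec d) : Fin n → Vec d :=
  fun i => ∑ j, M i j • u j

/-- The average `x̄` of the agents' vectors. -/
def mean {n d : ℕ} (x : Fin n → Vec d) : Vec d := (1 / (n : ℝ)) • ∑ i, x i

/-- The global cost `f = (1/n) ∑ f_i`. -/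
def globalCost {n d : ℕ} (f : Fin n → Vec d → ℝ) : Vec d → ℝ :=
  fun x => (1 / (n : ℝ)) * ∑ i, f i x

/-! ### Scalar parameters and derived constants -/

/-- The scalars on which the constants of the convergence result depend. -/
structure Params where
  /-- smoothness constant of the local costs -/
  ell : ℝ
  /-- spectral radius of the Laplacian -/
  rho : ℝ
  /-- smallest positive eigenvalue of the Laplacian -/
  rho2 : ℝ
  /-- the constant `d̂` -/
  dhat : ℝ
  /-- radius of the local region of the compressor -/
  C : ℝ
  /-- scaling of the compressor -/
  r : ℝ
  /-- contraction factor of the compressor -/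
  del : ℝ
  /-- algorithm parameter `γ` -/
  gam : ℝ
  /-- algorithm parameter `ω` -/
  om : ℝ
  /-- stepsize factor `τ₀` -/
  tau0 : ℝ
  /-- ratio `τ₁ = β / γ` -/
  tau1 : ℝ
  /-- factor `τ₄` of the initial scaling -/
  tau4 : ℝ

namespace Params

variable (c : Params)

def beta : ℝ := c.tau1 * c.gam

def eps1 : ℝ := (c.tau1 * c.rho2 - 1) / (2 * c.tau1 * c.rho2)

def eps5 : ℝ := c.om * c.r * (c.del - c.del ^ 2 / 2)

def eps8 : ℝ := (c.eps5 + 2 * c.eps5 ^ 2) / 2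

def phi1 : ℝ := (1 / 2) * (c.rho2 * c.beta - (3 * c.gam + 2 + 2 * c.ell ^ 2))

def phi2 : ℝ :=
  3 * c.rho ^ 2 * c.beta ^ 2 - c.rho2 * c.beta * c.gam + (c.rho + 2) * c.gam ^ 2
    + 1 + (5 / 2) * c.ell ^ 2

def phi3 : ℝ := c.gam / 2 - (5 / 2) * c.rho2⁻¹

def phi4 : ℝ := 2 * c.rho * c.gam ^ 2 + (1 / 2) * c.rho

def phi5 : ℝ :=
  1 / 8 - (c.beta + c.gam) ^ 2 / c.gam ^ 5 * c.rho2⁻¹ * c.ell ^ 2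
    - 1 / (2 * c.gam ^ 2) * (c.rho2⁻¹) ^ 2 * c.ell ^ 2

def phi6 : ℝ :=
  (c.beta + c.gam) / (2 * c.gam ^ 3) * c.rho2⁻¹ * c.ell ^ 2
    + 1 / (2 * c.gam ^ 2) * (c.rho2⁻¹) ^ 2 * c.ell ^ 2
    + (c.rho2⁻¹) ^ 2 / 2 * c.ell ^ 2 + c.ell ^ 2 / 2 + c.ell / 2

def phi7 : ℝ := (c.rho + 1) * c.gam + (1 / 2) * c.rho * c.beta

def phi8 : ℝ :=
  3 * c.rho ^ 2 * c.beta ^ 2 + (c.rho - 2 * c.rho2) * c.beta * c.gam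
    + (c.rho + 2) * c.gam ^ 2 + 1

/-- `ψ₂`, which depends on the stepsize `α`. -/
def psi2 (α : ℝ) : ℝ := c.phi7 + α * c.phi8

def psi3 : ℝ := 4 * (1 + c.eps5⁻¹) * c.dhat ^ 2 * c.beta ^ 2 * c.rho ^ 2

def psi4 : ℝ :=
  4 * (1 + c.eps5⁻¹) * c.dhat ^ 2
    * max (c.beta ^ 2 * c.rho ^ 2 + c.ell ^ 2) (c.gam ^ 2 * c.rho) / c.eps1

def kappaHat0 : ℝ := min (c.phi1 / c.phi2) (min (c.phi3 / c.phi4) (c.phi5 / c.phi6))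

def kappa1 : ℝ := 4 / c.rho2

def kappa2 : ℝ :=
  max (2 + 2 * c.ell ^ 2)
    (max (5 / c.rho2)
      (max ((16 * c.ell ^ 2 * (c.kappa1 + 1) ^ 2 / c.rho2) ^ (1 / 3 : ℝ))
        (2 * √2 * c.ell / c.rho2)))

def kappa7 : ℝ := min c.kappaHat0 (1 / (2 * c.ell))

/-- The stepsize `α = τ₀ / (n^{1/3} d̃^{2/3} T^{1/3})`. -/
def stepsize (n : ℕ) (dt : ℝ) (T : ℕ) : ℝ :=
  c.tau0 / ((n : ℝ) ^ (1 / 3 : ℝ) * dt ^ (2 / 3 : ℝ) * (T : ℝ) ^ (1 / 3 : ℝ))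

/-- `τ₀ ≤ κ₀` for `κ₀ = (ε₈ / (2 (1 - 2 ε₅) ψ₂ ψ₄))^{1/3}`, with the denominator cleared, so that
`κ₀ = ∞` (no restriction) when `1 - 2 ε₅ = 0`. -/
def Tau0LeKappa0 (α : ℝ) : Prop :=
  2 * (1 - 2 * c.eps5) * c.psi2 α * c.psi4 * c.tau0 ^ 3 ≤ c.eps8

def kappa3 (n : ℕ) (dt : ℝ) : ℝ :=
  max (c.tau0 ^ 3 / ((n : ℝ) * dt ^ 2 * c.kappa7 ^ 3))
    (((1 - 2 * c.eps5) * c.psi3 * c.tau0 ^ 2 / c.eps8) ^ (3 / 2 : ℝ)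
      * (n : ℝ) ^ (1 / 2 : ℝ) * dt)

/-- `κ₄`, where `V0` is the initial value of the Lyapunov function. -/
def kappa4 (n : ℕ) (V0 : ℝ) : ℝ := 2 * c.psi4 * V0 / (c.C ^ 2 * c.eps8 * n)

/-- The increment `κ̃₄(T)` of the recursion for `s_k²`; `V0` is the initial value of the Lyapunov
function, `s0` the initial scaling factor and `α` the stepsize. -/
def kappaTilde4 (n : ℕ) (dt V0 s0 α : ℝ) (T : ℕ) : ℝ :=
  c.psi4 * V0 * α ^ 2 / c.C ^ 2
    + (1 - 2 * c.eps5) * c.psi2 α * c.psi4 * n * dt ^ 2 * s0 ^ 2 * α ^ 3 * T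

/-- The Lyapunov function (consensus error, dual term, cross term and optimality gap) at primal
variables `x` and dual variables `v`, with the gap measured from the lower bound `flow`. -/
def lyapunov {n d : ℕ} (A : Matrix (Fin n) (Fin n) ℝ) (lam : ℝ) (f : Fin n → Vec d → ℝ)
    (flow : ℝ) (x v : Fin n → Vec d) : ℝ :=
  let w : Fin n → Vec d := fun i => v i + (1 / c.gam) • ∇ (f i) (mean x)
  (1 / 2) * bilin (matE n) x x
    + (1 / 2) * ((c.beta + c.gam) / c.gam) * bilin (matF A lam) w w
    + bilin (matE n * matF A lam) x w
    + n * (globalCost f (mean x) - flow)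

end Params

/-! ### The algorithm -/

/-- The variables of all agents at the start of iteration `k`:
`x_k`, `v_k`, `x̂_{k-1}` and `y_{k-1}`. -/
structure State (n d : ℕ) where
  x : Fin n → Vec d
  v : Fin n → Vec d
  xhat : Fin n → Vec d
  y : Fin n → Vec d

namespace State

variable {n d : ℕ}

/-- The primal and dual updates, once `x̂_k = xhat` and `y_k = y` have been computed. -/
def update (c : Params) (α : ℝ) (f : Fin n → Vec d → ℝ) (z : State n d)
    (xhat y : Fin n → Vec d) : State n d where
  x := fun i => z.x i - α • (c.beta • y i + c.gam • z.v i + ∇ (f i) (z.x i))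
  v := fun i => z.v i + (α * c.gam) • y i
  xhat := xhat
  y := y

/-- The compressed messages `q_k`. -/
def message (comp : Vec d → Vec d) (s : ℝ) (z : State n d) : Fin n → Vec d :=
  fun i => comp ((1 / s) • (z.x i - z.xhat i))

/-- One iteration of the algorithm with scaling factor `s`. -/
def step (c : Params) (A : Matrix (Fin n) (Fin n) ℝ) (α : ℝ) (f : Fin n → Vec d → ℝ)
    (comp : Vec d → Vec d) (s : ℝ) (z : State n d) : State n d :=
  z.update c α f
    (fun i => z.xhat i + (c.om * s) • z.message comp s i)
    (fun i => z.y i + (c.om * s) • applyMat (laplacian A) (z.message comp s) i)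

/-- The initialization of the algorithm. -/
def coldStart (x0 : Fin n → Vec d) : State n d where
  x := x0
  v := 0
  xhat := 0
  y := 0

/-- The initialization after an exact exchange of the initial vectors:
`x̂_{-1} = x_0` and `y_{-1} = L x_0`. -/
def warmStart (A : Matrix (Fin n) (Fin n) ℝ) (x0 : Fin n → Vec d) : State n d where
  x := x0
  v := 0
  xhat := x0
  y := applyMat (laplacian A) x0

/-- `z` is a run of the algorithm from `x0` with one initial uncompressed communication round.
Both implementations of that round are admitted: either the agents first exchange `x_0` exactly,
so that `x̂_{-1} = x_0`, `y_{-1} = L x_0`, and then iterate; or the exact exchange takes the place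
of the compressed exchange of iteration `0`, so that `x̂_0 = x_0`, `y_0 = L x_0`. -/
def IsRunWithExactFirstRound (c : Params) (A : Matrix (Fin n) (Fin n) ℝ) (α : ℝ)
    (f : Fin n → Vec d → ℝ) (comp : Vec d → Vec d) (s : ℕ → ℝ) (x0 : Fin n → Vec d)
    (z : ℕ → State n d) : Prop :=
  ((z 0 = warmStart A x0 ∧ z 1 = (z 0).step c A α f comp (s 0)) ∨
    (z 0 = coldStart x0 ∧ z 1 = (z 0).update c α f x0 (applyMat (laplacian A) x0))) ∧
  ∀ k, 1 ≤ k → z (k + 1) = (z k).step c A α f comp (s k)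

end State

end CompressedOpt

end

/-!
With the compression error `e = x - x̂` treated as a perturbation, the iteration decreases the
Lyapunov function. Its quadratic part is a Euclidean energy of the consensus error `E x` and the
dual error `w = v + ∇f(x̄) / γ`, and all matrices involved are functions of the Laplacian, so the
decrease can be computed with commuting symmetric operators on an inner product space: one step
gains `α (n ‖∇f(x̄)‖² + ∑ ‖x_i - x̄‖²)` up to a constant factor and loses at most
`α ψ₂ ∑ ‖e_i‖²`.

The compressor controls `e` only while its argument stays in the `ℓ_p` ball of radius `C`. That it
does so is shown by induction on time, jointly with the bound on the Lyapunov function: a bounded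
Lyapunov function bounds `x_{k+1} - x_k`, and the contraction `1 - ε₈` of the scaling factors
leaves room for exactly this movement. The increments of the Lyapunov function then sum to
`O(α³ n² d̃² T) = O(n)` by the choice of the stepsize, whence the time average of
`‖∇f(x̄)‖² + (1/n) ∑ ‖x_i - x̄‖²` is `O(1 / (α T))`, which is the rate.
-/

noncomputable section

namespace CompressedOpt

section Operators

variable {H : Type*} [NormedAddCommGroup H] [InnerProductSpace ℝ H]

lemma two_mul_inner_le_of_isPositive {K : Module.End ℝ H} (hK : K.IsPositive) (x y : H) :
    2 * ⟪x, K y⟫_ℝ ≤ ⟪x, K x⟫_ℝ + ⟪y, K y⟫_ℝ := by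
  have hnonneg : 0 ≤ ⟪x - y, K (x - y)⟫_ℝ := hK.inner_nonneg_right _
  have hsymm : ⟪y, K x⟫_ℝ = ⟪x, K y⟫_ℝ := by rw [← hK.isSymmetric, real_inner_comm]
  simp only [map_sub, inner_sub_left, inner_sub_right] at hnonneg
  linarith

section Projection

variable {E : Module.End ℝ H} (hE : E.IsSymmetricProjection)
include hE

lemma proj_proj (x : H) : E (E x) = E x := LinearMap.congr_fun hE.isIdempotentElem x

lemma inner_proj_eq (x y : H) : ⟪x, E y⟫_ℝ = ⟪E x, E y⟫_ℝ := by
  rw [hE.isSymmetric, proj_proj hE]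

lemma inner_proj_self (x : H) : ⟪x, E x⟫_ℝ = ‖E x‖ ^ 2 := by
  rw [inner_proj_eq hE, real_inner_self_eq_norm_sq]

lemma inner_sub_proj_self (x : H) : ⟪x, x - E x⟫_ℝ = ‖x - E x‖ ^ 2 := by
  rw [norm_sub_sq_real, inner_sub_right, inner_proj_self hE, real_inner_self_eq_norm_sq]
  ring

lemma norm_proj_le (x : H) : ‖E x‖ ≤ ‖x‖ := by
  have hsq : ‖E x‖ ^ 2 ≤ ‖x‖ ^ 2 := by
    have := inner_sub_proj_self hE x
    rw [inner_sub_right, inner_proj_self hE, real_inner_self_eq_norm_sq] at this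
    linarith [sq_nonneg ‖x - E x‖]
  exact le_of_sq_le_sq hsq (norm_nonneg x)

lemma abs_inner_proj_le (x y : H) : |⟪x, E y⟫_ℝ| ≤ ‖E x‖ * ‖y‖ := by
  rw [← hE.isSymmetric]
  exact abs_real_inner_le_norm _ _

lemma neg_inner_proj_le (x y : H) : -⟪x, E y⟫_ℝ ≤ ‖E x‖ * ‖y‖ :=
  (neg_le_abs _).trans (abs_inner_proj_le hE x y)

lemma norm_proj_le_add (x u : H) : ‖E u‖ ≤ ‖E x‖ + ‖x - u‖ := by
  calc ‖E u‖ = ‖E x - E (x - u)‖ := by rw [map_sub, sub_sub_cancel]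
    _ ≤ ‖E x‖ + ‖E (x - u)‖ := norm_sub_le _ _
    _ ≤ ‖E x‖ + ‖x - u‖ := by gcongr; exact norm_proj_le hE _

end Projection

/-- An orthogonal projection `E` commuting with an operator `K`, `lo ≤ K ≤ hi`, that acts as `lam`
on the kernel of `E`, together with the inverse `F` of `K`. For the network, these are `E`,
`L + (lam / n) 𝟏 𝟏ᵀ` and `F` acting on stacked vectors. -/
structure IsNetworkTriple (E K F : Module.End ℝ H) (lo hi lam : ℝ) : Prop where
  lo_pos : 0 < lo
  lo_le : lo ≤ lam
  le_hi : lam ≤ hi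
  proj : E.IsSymmetricProjection
  commute : Commute E K
  right_inv : K * F = 1
  left_inv : F * K = 1
  smul_one_le : lo • 1 ≤ K
  le_smul_one : K ≤ hi • 1
  mul_one_sub : K * (1 - E) = lam • (1 - E)

/-- The quadratic part of the Lyapunov function, `k` being the weight of the dual term. -/
def energy (E F : Module.End ℝ H) (k : ℝ) (x w : H) : ℝ :=
  (1 / 2) * ⟪x, E x⟫_ℝ + (1 / 2) * k * ⟪w, F w⟫_ℝ + ⟪x, E (F w)⟫_ℝ

namespace IsNetworkTriple

variable {E K F : Module.End ℝ H} {lo hi lam : ℝ} (N : IsNetworkTriple E K F lo hi lam)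
include N

lemma lam_pos : 0 < lam := N.lo_pos.trans_le N.lo_le

lemma hi_pos : 0 < hi := N.lam_pos.trans_le N.le_hi

lemma apply_inv (x : H) : K (F x) = x := LinearMap.congr_fun N.right_inv x

lemma inv_apply (x : H) : F (K x) = x := LinearMap.congr_fun N.left_inv x

lemma isPositive : K.IsPositive := by
  have hlo : (lo • (1 : Module.End ℝ H)).IsPositive :=
    LinearMap.isPositive_one.smul_of_nonneg N.lo_pos.le
  simpa only [sub_add_cancel] using ((LinearMap.le_def _ _).1 N.smul_one_le).add hlo

lemma mul_norm_sq_le (x : H) : lo * ‖x‖ ^ 2 ≤ ⟪x, K x⟫_ℝ := by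
  have h := ((LinearMap.le_def _ _).1 N.smul_one_le).inner_nonneg_right x
  rwa [LinearMap.sub_apply, LinearMap.smul_apply, Module.End.one_apply, inner_sub_right,
    real_inner_smul_right, real_inner_self_eq_norm_sq, sub_nonneg] at h

lemma le_mul_norm_sq (x : H) : ⟪x, K x⟫_ℝ ≤ hi * ‖x‖ ^ 2 := by
  have h := ((LinearMap.le_def _ _).1 N.le_smul_one).inner_nonneg_right x
  rwa [LinearMap.sub_apply, LinearMap.smul_apply, Module.End.one_apply, inner_sub_right,
    real_inner_smul_right, real_inner_self_eq_norm_sq, sub_nonneg] at h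

lemma proj_apply (x : H) : E (K x) = K (E x) := LinearMap.congr_fun N.commute.eq x

lemma proj_inv (x : H) : E (F x) = F (E x) := by
  rw [← N.inv_apply (E (F x)), ← N.proj_apply, N.apply_inv]

lemma inv_isSymmetric : F.IsSymmetric := fun x y => by
  conv_lhs => rw [← N.apply_inv y]
  rw [← N.isPositive.isSymmetric, N.apply_inv]

lemma proj_apply_proj (x : H) : E (K (E x)) = K (E x) := by
  rw [N.proj_apply, proj_proj N.proj]

lemma inner_apply_proj (x y : H) : ⟪x, K (E y)⟫_ℝ = ⟪E x, K (E y)⟫_ℝ := by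
  rw [N.proj.isSymmetric, N.proj_apply_proj]

lemma norm_apply_sq_le_inner (x : H) : ‖K x‖ ^ 2 ≤ hi * ⟪x, K x⟫_ℝ := by
  have hhi := N.hi_pos
  have hcs := two_mul_inner_le_of_isPositive N.isPositive (hi⁻¹ • K x) x
  have hupper : hi⁻¹ * (hi⁻¹ * ⟪K x, K (K x)⟫_ℝ) ≤ hi⁻¹ * ‖K x‖ ^ 2 := by
    gcongr
    exact inv_mul_le_of_le_mul₀ hhi.le (sq_nonneg _) (N.le_mul_norm_sq (K x))
  simp only [map_smul, real_inner_smul_left, real_inner_smul_right,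
    real_inner_self_eq_norm_sq] at hcs
  rw [← inv_mul_le_iff₀ hhi]
  linarith

lemma norm_apply_sq_le (x : H) : ‖K x‖ ^ 2 ≤ hi ^ 2 * ‖x‖ ^ 2 := by
  linarith [N.norm_apply_sq_le_inner x,
    mul_le_mul_of_nonneg_left (N.le_mul_norm_sq x) N.hi_pos.le]

lemma norm_sq_le_inner_inv (w : H) : ‖w‖ ^ 2 ≤ hi * ⟪w, F w⟫_ℝ := by
  simpa only [N.apply_inv, real_inner_comm] using N.norm_apply_sq_le_inner (F w)

lemma mul_norm_inv_sq_le (w : H) : lo * ‖F w‖ ^ 2 ≤ ⟪w, F w⟫_ℝ := by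
  simpa only [N.apply_inv, real_inner_comm] using N.mul_norm_sq_le (F w)

lemma inner_inv_nonneg (w : H) : 0 ≤ ⟪w, F w⟫_ℝ :=
  (mul_nonneg N.lo_pos.le (sq_nonneg _)).trans (N.mul_norm_inv_sq_le w)

lemma norm_inv_le (w : H) : ‖F w‖ ≤ lo⁻¹ * ‖w‖ := by
  rcases (norm_nonneg (F w)).eq_or_lt with hzero | hpos
  · rw [← hzero]
    exact mul_nonneg (inv_nonneg.2 N.lo_pos.le) (norm_nonneg w)
  · rw [le_inv_mul_iff₀ N.lo_pos]
    refine le_of_mul_le_mul_right ?_ hpos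
    linarith [N.mul_norm_inv_sq_le w, real_inner_le_norm w (F w)]

lemma inner_inv_le (w : H) : ⟪w, F w⟫_ℝ ≤ lo⁻¹ * ‖w‖ ^ 2 := by
  linarith [real_inner_le_norm w (F w),
    mul_le_mul_of_nonneg_left (N.norm_inv_le w) (norm_nonneg w)]

lemma abs_inner_proj_inv_le (x y : H) : |⟪x, E (F y)⟫_ℝ| ≤ ‖E x‖ * (lo⁻¹ * ‖y‖) :=
  (abs_inner_proj_le N.proj x (F y)).trans
    (mul_le_mul_of_nonneg_left (N.norm_inv_le y) (norm_nonneg _))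

lemma inv_sub_proj (w : H) : F (w - E w) = lam⁻¹ • (w - E w) := by
  have hK : K (w - E w) = lam • (w - E w) := LinearMap.congr_fun N.mul_one_sub w
  rw [← N.inv_apply (lam⁻¹ • (w - E w)), map_smul, hK, inv_smul_smul₀ N.lam_pos.ne']

lemma inner_inv_eq (w : H) :
    ⟪w, F w⟫_ℝ = ⟪w, E (F w)⟫_ℝ + lam⁻¹ * ‖w - E w‖ ^ 2 := by
  have hsplit : F w = E (F w) + lam⁻¹ • (w - E w) := by
    rw [← N.inv_sub_proj, map_sub, N.proj_inv, add_sub_cancel]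
  conv_lhs => rw [hsplit]
  rw [inner_add_right, real_inner_smul_right, inner_sub_proj_self N.proj]

lemma neg_inner_proj_inv_le_half {t : ℝ} (ht : 0 < t) (x w : H) :
    -⟪x, E (F w)⟫_ℝ ≤ 1 / (2 * t * lo) * ‖E x‖ ^ 2 + t / 2 * ⟪w, F w⟫_ℝ := by
  have hlo := N.lo_pos
  have hyoung := two_mul_le_add_mul_sq (a := ‖F w‖) (b := ‖E x‖) (mul_pos ht hlo)
  have hinv : 1 / (2 * t * lo) = (t * lo)⁻¹ / 2 := by field_simp
  rw [hinv]
  linarith [neg_inner_proj_le N.proj x (F w),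
    mul_le_mul_of_nonneg_left (N.mul_norm_inv_sq_le w) ht.le]

lemma le_energy {t : ℝ} (ht : 0 < t) (x w : H) :
    (t * lo - 1) / (2 * t * lo) * (‖E x‖ ^ 2 + ⟪w, F w⟫_ℝ) ≤ energy E F (t + 1) x w := by
  have hlo := N.lo_pos
  have hcoef : (t * lo - 1) / (2 * t * lo) = 1 / 2 - 1 / (2 * t * lo) := by field_simp
  have hdual : 0 ≤ 1 / (2 * t * lo) * ⟪w, F w⟫_ℝ :=
    mul_nonneg (by positivity) (N.inner_inv_nonneg w)
  rw [hcoef, energy, inner_proj_self N.proj]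
  linarith [N.neg_inner_proj_inv_le_half ht x w]

-- The expansion in powers of `a`, with the contribution of `D` kept apart.
lemma energy_step_eq {g : ℝ} (hg : g ≠ 0) (t a : ℝ) (x u w h D : H) :
    energy E F (t + 1) (x - a • ((t * g) • K (E u) + g • w + h))
        (w + (a * g) • K (E u) + g⁻¹ • D)
      = energy E F (t + 1) x w
        + a * (-(t * g) * ⟪x, K (E u)⟫_ℝ - ⟪x, E h⟫_ℝ + g * ⟪x, E u⟫_ℝ
          + g * ⟪u - x, E w⟫_ℝ - g * ⟪w, E (F w)⟫_ℝ - ⟪h, E (F w)⟫_ℝ)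
        + ((t + 1) / g * ⟪w, F D⟫_ℝ + g⁻¹ * ⟪x, E (F D)⟫_ℝ)
        + a ^ 2 * ((1 / 2) * (t * g) ^ 2 * ‖K (E u)‖ ^ 2
          + (1 / 2) * g * (g - t * g) * ⟪u, K (E u)⟫_ℝ + (1 / 2) * ‖E (g • w + h)‖ ^ 2
          + ⟪(t * g) • K (E u) - g • E u, g • w + h⟫_ℝ)
        + a * (⟪u, E D⟫_ℝ - ⟪w, E (F D)⟫_ℝ - g⁻¹ * ⟪h, E (F D)⟫_ℝ)
        + (t + 1) / (2 * g ^ 2) * ⟪D, F D⟫_ℝ := by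
  have hswapE : ∀ y z, ⟪y, E z⟫_ℝ = ⟪z, E y⟫_ℝ := fun y z => by
    rw [← N.proj.isSymmetric, real_inner_comm]
  have hswapF : ∀ y z, ⟪y, F z⟫_ℝ = ⟪z, F y⟫_ℝ := fun y z => by
    rw [← N.inv_isSymmetric, real_inner_comm]
  have hKE : ∀ y, ⟪K (E u), E y⟫_ℝ = ⟪y, K (E u)⟫_ℝ := fun y => by
    rw [hswapE, N.proj_apply_proj]
  have hKF : ∀ y, ⟪K (E u), F y⟫_ℝ = ⟪u, E y⟫_ℝ := fun y => by
    rw [hswapF, N.inv_apply, hswapE]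
  have hFK : ∀ y, ⟪F y, K (E u)⟫_ℝ = ⟪u, E y⟫_ℝ := fun y => by rw [real_inner_comm, hKF]
  rw [← inner_proj_self N.proj (g • w + h)]
  simp only [energy, map_add, map_sub, map_smul, inner_add_left, inner_add_right, inner_sub_left,
    inner_sub_right, real_inner_smul_left, real_inner_smul_right, N.inv_apply, N.proj_apply_proj,
    proj_proj N.proj, hKE, hKF, hFK, real_inner_self_eq_norm_sq, N.proj.isSymmetric _ (_ : H)]
  rw [hswapE w x, hswapE h x, hswapE h w, hswapE w u, hswapE h u, hswapE D u, hswapF D w,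
    real_inner_comm w (K (E u)), real_inner_comm h (K (E u))]
  field_simp
  ring

end IsNetworkTriple
end Operators

section EnergyDecrease

namespace IsNetworkTriple

variable {H : Type*} [NormedAddCommGroup H] [InnerProductSpace ℝ H] {E K F : Module.End ℝ H}
  {lo hi lam : ℝ} (N : IsNetworkTriple E K F lo hi lam)
include N

lemma neg_inner_apply_proj_le (x u : H) :
    -⟪x, K (E u)⟫_ℝ ≤ -(1 / 2) * lo * ‖E x‖ ^ 2 + (1 / 2) * hi * ‖x - u‖ ^ 2 := by
  have hcs := two_mul_inner_le_of_isPositive N.isPositive (E x) (E (x - u))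
  have hproj : hi * ‖E (x - u)‖ ^ 2 ≤ hi * ‖x - u‖ ^ 2 := by
    have := N.hi_pos.le
    gcongr
    exact norm_proj_le N.proj _
  have hsplit : ⟪x, K (E u)⟫_ℝ = ⟪E x, K (E x)⟫_ℝ - ⟪E x, K (E (x - u))⟫_ℝ := by
    rw [N.inner_apply_proj, map_sub, map_sub, inner_sub_right, sub_sub_cancel]
  linarith [N.mul_norm_sq_le (E x), N.le_mul_norm_sq (E (x - u))]

lemma neg_inner_proj_le_of_norm_le {l : ℝ} {x h : H} (hh : ‖h‖ ≤ l * ‖E x‖) :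
    -⟪x, E h⟫_ℝ ≤ (1 + l ^ 2 / 4) * ‖E x‖ ^ 2 := by
  have hnorm := mul_le_mul_of_nonneg_left hh (norm_nonneg (E x))
  linarith [neg_inner_proj_le N.proj x h, mul_nonneg (sq_nonneg (l / 2 - 1)) (sq_nonneg ‖E x‖)]

lemma inner_proj_le_add (x u : H) :
    ⟪x, E u⟫_ℝ ≤ (3 / 2) * ‖E x‖ ^ 2 + (1 / 2) * ‖x - u‖ ^ 2 := by
  have hsplit : ⟪x, E u⟫_ℝ = ‖E x‖ ^ 2 - ⟪x, E (x - u)⟫_ℝ := by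
    rw [map_sub, inner_sub_right, inner_proj_self N.proj, sub_sub_cancel]
  linarith [neg_inner_proj_le N.proj x (x - u), two_mul_le_add_sq ‖E x‖ ‖x - u‖]

lemma inner_sub_proj_le (x u w : H) :
    ⟪u - x, E w⟫_ℝ ≤ hi * ‖x - u‖ ^ 2 + (1 / 4) * ⟪w, F w⟫_ℝ := by
  have hhi := N.hi_pos
  have hcs : ⟪u - x, E w⟫_ℝ ≤ ‖x - u‖ * ‖w‖ := by
    rw [← neg_sub, inner_neg_left]
    exact (neg_inner_proj_le N.proj _ w).trans (by gcongr; exact norm_proj_le N.proj _)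
  have hyoung := two_mul_le_add_mul_sq (a := ‖x - u‖) (b := ‖w‖) (by positivity : 0 < 2 * hi)
  have hdual : (2 * hi)⁻¹ * ‖w‖ ^ 2 ≤ (1 / 2) * ⟪w, F w⟫_ℝ := by
    rw [inv_mul_le_iff₀ (by positivity)]
    linarith [N.norm_sq_le_inner_inv w]
  linarith

lemma neg_inner_proj_inv_self_le {g : ℝ} (hglo : 5 ≤ g * lo) (w : H) :
    -g * ⟪w, E (F w)⟫_ℝ ≤ -g * ⟪w, F w⟫_ℝ + g ^ 2 / 5 * ‖w - E w‖ ^ 2 := by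
  have hg : 0 ≤ g := (pos_of_mul_pos_left (by linarith) N.lo_pos.le).le
  have hcoef : g * lam⁻¹ ≤ g ^ 2 / 5 := by
    rw [← div_eq_mul_inv, div_le_div_iff₀ N.lam_pos (by norm_num), sq, mul_assoc]
    exact mul_le_mul_of_nonneg_left (hglo.trans (mul_le_mul_of_nonneg_left N.lo_le hg)) hg
  rw [N.inner_inv_eq w]
  linarith [mul_le_mul_of_nonneg_right hcoef (sq_nonneg ‖w - E w‖)]

lemma neg_inner_proj_inv_le_of_norm_le {l : ℝ} {x h : H} (hh : ‖h‖ ≤ l * ‖E x‖) (w : H) :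
    -⟪h, E (F w)⟫_ℝ ≤ (5 / 2) * lo⁻¹ * ⟪w, F w⟫_ℝ + l ^ 2 / 10 * ‖E x‖ ^ 2 := by
  have hcs : -⟪h, E (F w)⟫_ℝ ≤ l * ‖E x‖ * ‖F w‖ :=
    (neg_inner_proj_le N.proj h (F w)).trans
      (by gcongr; exact (norm_proj_le N.proj h).trans hh)
  have hFw : ‖F w‖ ^ 2 ≤ lo⁻¹ * ⟪w, F w⟫_ℝ := by
    rw [le_inv_mul_iff₀ N.lo_pos]
    exact N.mul_norm_inv_sq_le w
  linarith [sq_nonneg (l * ‖E x‖ - 5 * ‖F w‖)]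

lemma first_order_le {l b g : ℝ} (hb : 0 ≤ b) (hglo : 5 ≤ g * lo) {x h : H} (u w : H)
    (hh : ‖h‖ ≤ l * ‖E x‖) :
    -b * ⟪x, K (E u)⟫_ℝ - ⟪x, E h⟫_ℝ + g * ⟪x, E u⟫_ℝ + g * ⟪u - x, E w⟫_ℝ
          - g * ⟪w, E (F w)⟫_ℝ - ⟪h, E (F w)⟫_ℝ
      ≤ -((1 / 2) * b * lo - (3 / 2) * g - 1 - (7 / 20) * l ^ 2) * ‖E x‖ ^ 2
        - ((3 / 4) * g - (5 / 2) * lo⁻¹) * ⟪w, F w⟫_ℝ + g ^ 2 / 5 * ‖w - E w‖ ^ 2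
        + ((hi + 1) * g + (1 / 2) * hi * b) * ‖x - u‖ ^ 2 := by
  have hg : 0 ≤ g := (pos_of_mul_pos_left (by linarith) N.lo_pos.le).le
  linarith [mul_le_mul_of_nonneg_left (N.neg_inner_apply_proj_le x u) hb,
    N.neg_inner_proj_le_of_norm_le hh, mul_le_mul_of_nonneg_left (N.inner_proj_le_add x u) hg,
    mul_le_mul_of_nonneg_left (N.inner_sub_proj_le x u w) hg,
    N.neg_inner_proj_inv_self_le hglo w, N.neg_inner_proj_inv_le_of_norm_le hh w,
    mul_nonneg hg (sq_nonneg ‖x - u‖)]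

lemma inner_inv_drift_le {l g k a G : ℝ} (hg : 0 < g) (hk : 0 ≤ k) (ha : 0 ≤ a) (w : H) {D : H}
    (hD : ‖D‖ ≤ l * (a * G)) :
    k / g * ⟪w, F D⟫_ℝ
      ≤ a * (g / 4 * ⟪w, F w⟫_ℝ + k ^ 2 / g ^ 3 * lo⁻¹ * l ^ 2 * G ^ 2) := by
  have hlo := N.lo_pos
  have hcs : k / g * ⟪w, F D⟫_ℝ ≤ a * (‖F w‖ * (k / g * l * G)) := by
    have hinner : ⟪w, F D⟫_ℝ ≤ ‖F w‖ * (l * (a * G)) := by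
      rw [← N.inv_isSymmetric]
      exact (real_inner_le_norm _ _).trans (by gcongr)
    linarith [mul_le_mul_of_nonneg_left hinner (by positivity : 0 ≤ k / g)]
  have hyoung : ‖F w‖ * (k / g * l * G)
      ≤ g / 4 * (lo * ‖F w‖ ^ 2) + k ^ 2 / g ^ 3 * lo⁻¹ * l ^ 2 * G ^ 2 := by
    have h := two_mul_le_add_mul_sq (a := ‖F w‖) (b := k / g * l * G)
      (by positivity : 0 < g * lo / 2)
    have hcoef : (g * lo / 2)⁻¹ * (k / g * l * G) ^ 2
        = 2 * (k ^ 2 / g ^ 3 * lo⁻¹ * l ^ 2 * G ^ 2) := by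
      field_simp
    linarith
  refine hcs.trans (mul_le_mul_of_nonneg_left (hyoung.trans ?_) ha)
  gcongr
  exact N.mul_norm_inv_sq_le w

lemma inner_proj_inv_drift_le {l g a G : ℝ} (hglo : 5 ≤ g * lo) (hl : 0 ≤ l) (ha : 0 ≤ a)
    (hG : 0 ≤ G) (x : H) {D : H} (hD : ‖D‖ ≤ l * (a * G)) :
    g⁻¹ * ⟪x, E (F D)⟫_ℝ ≤ a * (l ^ 2 / 10 * ‖E x‖ ^ 2 + 1 / 10 * G ^ 2) := by
  have hlo := N.lo_pos
  have hg : 0 < g := pos_of_mul_pos_left (by linarith) hlo.le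
  have hcs : ⟪x, E (F D)⟫_ℝ ≤ ‖E x‖ * (lo⁻¹ * (l * (a * G))) :=
    (le_abs_self _).trans ((N.abs_inner_proj_inv_le x D).trans (by gcongr))
  have hcoef : g⁻¹ * lo⁻¹ ≤ 1 / 5 := by
    rw [← mul_inv, one_div]
    exact inv_anti₀ (by norm_num) hglo
  linarith [mul_le_mul_of_nonneg_left hcs (inv_nonneg.2 hg.le),
    mul_le_mul_of_nonneg_right hcoef (by positivity : 0 ≤ a * (l * ‖E x‖ * G)),
    mul_nonneg ha (sq_nonneg (l * ‖E x‖ - G))]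

lemma norm_proj_smul_add_sq_le {l g : ℝ} (hg : 0 ≤ g) {x h : H} (w : H)
    (hh : ‖h‖ ≤ l * ‖E x‖) :
    ‖E (g • w + h)‖ ^ 2 ≤ 2 * hi * g ^ 2 * ⟪w, F w⟫_ℝ + 2 * l ^ 2 * ‖E x‖ ^ 2 := by
  have htriangle : ‖E (g • w + h)‖ ≤ g * ‖w‖ + l * ‖E x‖ := by
    refine (norm_proj_le N.proj _).trans ((norm_add_le _ _).trans ?_)
    rw [norm_smul, Real.norm_of_nonneg hg]
    gcongr
  calc ‖E (g • w + h)‖ ^ 2 ≤ (g * ‖w‖ + l * ‖E x‖) ^ 2 := by gcongr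
    _ ≤ 2 * ((g * ‖w‖) ^ 2 + (l * ‖E x‖) ^ 2) := add_sq_le
    _ ≤ 2 * hi * g ^ 2 * ⟪w, F w⟫_ℝ + 2 * l ^ 2 * ‖E x‖ ^ 2 := by
      linarith [mul_le_mul_of_nonneg_left (N.norm_sq_le_inner_inv w) (sq_nonneg g)]

lemma inner_smul_sub_smul_le (b g : ℝ) (u v : H) :
    ⟪b • K (E u) - g • E u, v⟫_ℝ
      ≤ (1 / 2) * (b ^ 2 * ‖K (E u)‖ ^ 2 - 2 * b * g * ⟪u, K (E u)⟫_ℝ + g ^ 2 * ‖E u‖ ^ 2)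
        + (1 / 2) * ‖E v‖ ^ 2 := by
  have hproj : E (b • K (E u) - g • E u) = b • K (E u) - g • E u := by
    simp only [map_sub, map_smul, N.proj_apply_proj, proj_proj N.proj]
  have hnorm : ‖b • K (E u) - g • E u‖ ^ 2
      = b ^ 2 * ‖K (E u)‖ ^ 2 - 2 * b * g * ⟪u, K (E u)⟫_ℝ + g ^ 2 * ‖E u‖ ^ 2 := by
    rw [norm_sub_sq_real, norm_smul, norm_smul, mul_pow, mul_pow, Real.norm_eq_abs,
      Real.norm_eq_abs, sq_abs, sq_abs, real_inner_smul_left, real_inner_smul_right,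
      N.inner_apply_proj, real_inner_comm (E u)]
    ring
  rw [← hnorm, ← hproj, N.proj.isSymmetric, inner_proj_eq N.proj, hproj]
  linarith [real_inner_le_norm (b • K (E u) - g • E u) (E v),
    two_mul_le_add_sq ‖b • K (E u) - g • E u‖ ‖E v‖]

lemma second_order_le {l b g : ℝ} (hb : 0 ≤ b) (hg : 0 ≤ g) {x h : H} (u w : H)
    (hh : ‖h‖ ≤ l * ‖E x‖) :
    (1 / 2) * b ^ 2 * ‖K (E u)‖ ^ 2 + (1 / 2) * g * (g - b) * ⟪u, K (E u)⟫_ℝ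
          + (1 / 2) * ‖E (g • w + h)‖ ^ 2 + ⟪b • K (E u) - g • E u, g • w + h⟫_ℝ
      ≤ (2 * hi ^ 2 * b ^ 2 + (hi + 1) * g ^ 2) * (‖E x‖ ^ 2 + ‖x - u‖ ^ 2)
        + 2 * l ^ 2 * ‖E x‖ ^ 2 + 2 * hi * g ^ 2 * ⟪w, F w⟫_ℝ := by
  have hhi := N.hi_pos
  have hEu : ‖E u‖ ^ 2 ≤ 2 * (‖E x‖ ^ 2 + ‖x - u‖ ^ 2) :=
    (pow_le_pow_left₀ (norm_nonneg _) (norm_proj_le_add N.proj x u) 2).trans add_sq_le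
  have hform : 0 ≤ ⟪u, K (E u)⟫_ℝ := by
    rw [N.inner_apply_proj]
    exact N.isPositive.inner_nonneg_right _
  have hform_le : ⟪u, K (E u)⟫_ℝ ≤ hi * ‖E u‖ ^ 2 := by
    rw [N.inner_apply_proj]
    exact N.le_mul_norm_sq _
  linarith [mul_le_mul_of_nonneg_left (N.norm_apply_sq_le (E u)) (sq_nonneg b),
    mul_le_mul_of_nonneg_left hform_le (sq_nonneg g), mul_nonneg (mul_nonneg hb hg) hform,
    mul_le_mul_of_nonneg_left hEu
      (by positivity : 0 ≤ b ^ 2 * hi ^ 2 + (1 / 2) * g ^ 2 * hi + (1 / 2) * g ^ 2),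
    N.norm_proj_smul_add_sq_le hg w hh, N.inner_smul_sub_smul_le b g u (g • w + h)]

lemma inner_proj_drift_le {l a G : ℝ} (ha : 0 ≤ a) (x u : H) {D : H}
    (hD : ‖D‖ ≤ l * (a * G)) :
    ⟪u, E D⟫_ℝ ≤ a * (‖E x‖ ^ 2 + ‖x - u‖ ^ 2 + l ^ 2 / 2 * G ^ 2) := by
  have hcs : ⟪u, E D⟫_ℝ ≤ (‖E x‖ + ‖x - u‖) * (l * (a * G)) :=
    (le_abs_self _).trans ((abs_inner_proj_le N.proj u D).trans
      (by gcongr; exact norm_proj_le_add N.proj x u))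
  linarith [mul_nonneg ha (sq_nonneg (‖E x‖ + ‖x - u‖ - l * G)),
    mul_nonneg ha (sq_nonneg (‖E x‖ - ‖x - u‖))]

lemma neg_inner_proj_inv_drift_le {l a G : ℝ} (ha : 0 ≤ a) (w : H) {D : H}
    (hD : ‖D‖ ≤ l * (a * G)) :
    -⟪w, E (F D)⟫_ℝ ≤ a * ((1 / 2) * hi * ⟪w, F w⟫_ℝ + lo⁻¹ ^ 2 / 2 * l ^ 2 * G ^ 2) := by
  have hlo := N.lo_pos
  have hcs : -⟪w, E (F D)⟫_ℝ ≤ ‖w‖ * (lo⁻¹ * (l * (a * G))) :=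
    (neg_le_abs _).trans ((N.abs_inner_proj_inv_le w D).trans
      (by gcongr; exact norm_proj_le N.proj w))
  linarith [mul_nonneg ha (sq_nonneg (‖w‖ - lo⁻¹ * l * G)),
    mul_le_mul_of_nonneg_left (N.norm_sq_le_inner_inv w) ha]

lemma neg_inner_proj_inv_grad_drift_le {l g a G : ℝ} (hg : 0 < g) (ha : 0 ≤ a) {x h D : H}
    (hh : ‖h‖ ≤ l * ‖E x‖) (hD : ‖D‖ ≤ l * (a * G)) :
    -(g⁻¹ * ⟪h, E (F D)⟫_ℝ)
      ≤ a * ((1 / 2) * l ^ 2 * ‖E x‖ ^ 2 + 1 / (2 * g ^ 2) * lo⁻¹ ^ 2 * l ^ 2 * G ^ 2) := by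
  have hlo := N.lo_pos
  have hcs : -⟪h, E (F D)⟫_ℝ ≤ (l * ‖E x‖) * (lo⁻¹ * (l * (a * G))) :=
    (neg_le_abs _).trans ((N.abs_inner_proj_inv_le h D).trans
      (mul_le_mul ((norm_proj_le N.proj h).trans hh) (by gcongr) (by positivity)
        ((norm_nonneg h).trans hh)))
  have hcoef : 1 / (2 * g ^ 2) = (1 / 2) * g⁻¹ ^ 2 := by field_simp
  rw [hcoef]
  linarith [mul_le_mul_of_nonneg_left hcs (inv_nonneg.2 hg.le),
    mul_nonneg ha (sq_nonneg (l * ‖E x‖ - g⁻¹ * lo⁻¹ * l * G))]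

lemma inner_inv_drift_self_le {l g k a G : ℝ} (hk : 0 ≤ k) {D : H} (hD : ‖D‖ ≤ l * (a * G)) :
    k / (2 * g ^ 2) * ⟪D, F D⟫_ℝ ≤ a ^ 2 * (k / (2 * g ^ 2) * lo⁻¹ * l ^ 2 * G ^ 2) := by
  have hlo := N.lo_pos
  calc k / (2 * g ^ 2) * ⟪D, F D⟫_ℝ
      ≤ k / (2 * g ^ 2) * (lo⁻¹ * (l * (a * G)) ^ 2) := by
        gcongr
        exact (N.inner_inv_le D).trans (by gcongr)
    _ = a ^ 2 * (k / (2 * g ^ 2) * lo⁻¹ * l ^ 2 * G ^ 2) := by ring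

lemma second_order_drift_le {l g k a G : ℝ} (hg : 0 < g) (hk : 0 ≤ k) (ha : 0 ≤ a)
    {x h D : H} (u w : H) (hh : ‖h‖ ≤ l * ‖E x‖) (hD : ‖D‖ ≤ l * (a * G)) :
    a * (⟪u, E D⟫_ℝ - ⟪w, E (F D)⟫_ℝ - g⁻¹ * ⟪h, E (F D)⟫_ℝ) + k / (2 * g ^ 2) * ⟪D, F D⟫_ℝ
      ≤ a ^ 2 * (‖E x‖ ^ 2 + ‖x - u‖ ^ 2 + (1 / 2) * hi * ⟪w, F w⟫_ℝ
        + (1 / 2) * l ^ 2 * ‖E x‖ ^ 2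
        + (k / (2 * g ^ 2) * lo⁻¹ * l ^ 2 + 1 / (2 * g ^ 2) * lo⁻¹ ^ 2 * l ^ 2
          + lo⁻¹ ^ 2 / 2 * l ^ 2 + l ^ 2 / 2) * G ^ 2) := by
  linarith [N.inner_inv_drift_self_le (g := g) hk hD,
    mul_le_mul_of_nonneg_left (N.inner_proj_drift_le ha x u hD) ha,
    mul_le_mul_of_nonneg_left (N.neg_inner_proj_inv_drift_le ha w hD) ha,
    mul_le_mul_of_nonneg_left (N.neg_inner_proj_inv_grad_drift_le hg ha hh hD) ha]

end IsNetworkTriple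
end EnergyDecrease

section Parameters

namespace Params

/-- The standing assumptions on the parameters. -/
structure Admissible (c : Params) : Prop where
  ell_pos : 0 < c.ell
  C_pos : 0 < c.C
  r_pos : 0 < c.r
  del_pos : 0 < c.del
  del_le : c.del ≤ 1
  om_pos : 0 < c.om
  om_mul_r_le : c.om * c.r ≤ 1
  rho2_pos : 0 < c.rho2
  rho2_le : c.rho2 ≤ c.rho
  dhat_pos : 0 < c.dhat
  kappaHat0_pos : 0 < c.kappaHat0
  tau0_pos : 0 < c.tau0

namespace Admissible

variable {c : Params} (hc : c.Admissible)
include hc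

lemma rho_pos : 0 < c.rho := hc.rho2_pos.trans_le hc.rho2_le

lemma phi4_pos : 0 < c.phi4 := by
  have := hc.rho_pos
  rw [phi4]
  positivity

lemma phi3_pos : 0 < c.phi3 := by
  have hdiv : 0 < c.phi3 / c.phi4 :=
    hc.kappaHat0_pos.trans_le ((min_le_right _ _).trans (min_le_left _ _))
  exact (div_pos_iff_of_pos_right hc.phi4_pos).1 hdiv

lemma five_lt_gam_mul_rho2 : 5 < c.gam * c.rho2 := by
  have hphi3 := hc.phi3_pos
  rw [phi3] at hphi3
  rw [← div_lt_iff₀ hc.rho2_pos, div_eq_mul_inv]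
  linarith

lemma gam_pos : 0 < c.gam :=
  pos_of_mul_pos_left (by linarith [hc.five_lt_gam_mul_rho2]) hc.rho2_pos.le

lemma rho2_mul_beta_mul_gam_le :
    c.rho2 * c.beta * c.gam ≤ c.rho ^ 2 * c.beta ^ 2 + c.gam ^ 2 := by
  have hrho2 : c.rho2 ^ 2 * c.beta ^ 2 ≤ c.rho ^ 2 * c.beta ^ 2 := by
    have := hc.rho2_pos.le
    have := hc.rho2_le
    gcongr
  linarith [two_mul_le_add_sq (c.rho2 * c.beta) c.gam, sq_nonneg (c.rho2 * c.beta),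
    sq_nonneg c.gam]

lemma phi2_pos : 0 < c.phi2 := by
  have hrho := hc.rho_pos
  have : 0 ≤ 2 * c.rho ^ 2 * c.beta ^ 2 + (c.rho + 1) * c.gam ^ 2 + (5 / 2) * c.ell ^ 2 := by
    positivity
  rw [phi2]
  linarith [hc.rho2_mul_beta_mul_gam_le]

lemma phi1_pos : 0 < c.phi1 :=
  (div_pos_iff_of_pos_right hc.phi2_pos).1 (hc.kappaHat0_pos.trans_le (min_le_left _ _))

lemma three_mul_gam_lt : 3 * c.gam < c.rho2 * c.beta := by
  have hphi1 := hc.phi1_pos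
  rw [phi1] at hphi1
  linarith [sq_nonneg c.ell]

lemma one_lt_tau1_mul_rho2 : 1 < c.tau1 * c.rho2 := by
  refine lt_of_mul_lt_mul_right ?_ hc.gam_pos.le
  have hbeta := hc.three_mul_gam_lt
  rw [beta] at hbeta
  linarith [hc.gam_pos]

lemma tau1_pos : 0 < c.tau1 :=
  pos_of_mul_pos_left (by linarith [hc.one_lt_tau1_mul_rho2]) hc.rho2_pos.le

lemma beta_pos : 0 < c.beta := mul_pos hc.tau1_pos hc.gam_pos

lemma phi6_pos : 0 < c.phi6 := by
  have := hc.ell_pos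
  have := hc.gam_pos
  have := hc.beta_pos
  have := hc.rho2_pos
  rw [phi6]
  positivity

lemma phi7_nonneg : 0 ≤ c.phi7 := by
  have := hc.beta_pos
  have := hc.gam_pos
  have := hc.rho_pos
  rw [phi7]
  positivity

lemma phi8_nonneg : 0 ≤ c.phi8 := by
  have := hc.beta_pos
  have := hc.gam_pos
  have := hc.rho_pos
  have : 0 ≤ c.rho ^ 2 * c.beta ^ 2 + c.rho * c.beta * c.gam + c.rho * c.gam ^ 2 := by
    positivity
  rw [phi8]
  linarith [hc.rho2_mul_beta_mul_gam_le]

lemma psi2_nonneg {α : ℝ} (hα : 0 ≤ α) : 0 ≤ c.psi2 α :=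
  add_nonneg hc.phi7_nonneg (mul_nonneg hα hc.phi8_nonneg)

lemma eps1_pos : 0 < c.eps1 := by
  have := hc.tau1_pos
  have := hc.rho2_pos
  have := sub_pos.2 hc.one_lt_tau1_mul_rho2
  rw [eps1]
  positivity

lemma eps5_pos : 0 < c.eps5 := by
  have : 0 < c.del - c.del ^ 2 / 2 := by nlinarith [hc.del_pos, hc.del_le]
  exact mul_pos (mul_pos hc.om_pos hc.r_pos) this

lemma eps5_le_half : c.eps5 ≤ 1 / 2 := by
  have hdel : c.del - c.del ^ 2 / 2 ≤ 1 / 2 := by linarith [sq_nonneg (c.del - 1)]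
  have homr : 0 ≤ c.om * c.r := (mul_pos hc.om_pos hc.r_pos).le
  rw [eps5]
  linarith [mul_le_mul_of_nonneg_left hdel homr, hc.om_mul_r_le]

lemma one_sub_two_mul_eps5_nonneg : 0 ≤ 1 - 2 * c.eps5 := by linarith [hc.eps5_le_half]

lemma eps8_pos : 0 < c.eps8 := by
  have := hc.eps5_pos
  rw [eps8]
  positivity

lemma eps8_le_one : c.eps8 ≤ 1 := by
  rw [eps8]
  nlinarith [hc.eps5_pos, hc.eps5_le_half]

lemma psi3_nonneg : 0 ≤ c.psi3 := by
  have := hc.eps5_pos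
  rw [psi3]
  positivity

lemma psi4_pos : 0 < c.psi4 := by
  have := hc.eps5_pos
  have := hc.eps1_pos
  have := hc.dhat_pos
  have := hc.gam_pos
  have := hc.rho_pos
  have : 0 < max (c.beta ^ 2 * c.rho ^ 2 + c.ell ^ 2) (c.gam ^ 2 * c.rho) :=
    lt_max_of_lt_right (by positivity)
  rw [psi4]
  positivity

lemma kappa7_pos : 0 < c.kappa7 :=
  lt_min hc.kappaHat0_pos (by have := hc.ell_pos; positivity)

lemma mul_phi2_le {α : ℝ} (hα : α ≤ c.kappa7) : α * c.phi2 ≤ c.phi1 :=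
  (le_div_iff₀ hc.phi2_pos).1 (hα.trans ((min_le_left _ _).trans (min_le_left _ _)))

lemma mul_phi4_le {α : ℝ} (hα : α ≤ c.kappa7) : α * c.phi4 ≤ c.phi3 :=
  (le_div_iff₀ hc.phi4_pos).1
    (hα.trans ((min_le_left _ _).trans ((min_le_right _ _).trans (min_le_left _ _))))

lemma mul_phi6_le {α : ℝ} (hα : α ≤ c.kappa7) : α * c.phi6 ≤ c.phi5 :=
  (le_div_iff₀ hc.phi6_pos).1
    (hα.trans ((min_le_left _ _).trans ((min_le_right _ _).trans (min_le_right _ _))))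

lemma first_order_drift_coeff_le :
    (c.tau1 + 1) ^ 2 / c.gam ^ 3 * c.rho2⁻¹ * c.ell ^ 2 + 1 / 10 ≤ 9 / 40 - c.phi5 := by
  have := hc.gam_pos
  have hcoef : (c.beta + c.gam) ^ 2 / c.gam ^ 5 = (c.tau1 + 1) ^ 2 / c.gam ^ 3 := by
    rw [beta]
    field_simp
  have : 0 ≤ 1 / (2 * c.gam ^ 2) * (c.rho2⁻¹) ^ 2 * c.ell ^ 2 := by positivity
  rw [phi5, hcoef]
  linarith

lemma second_order_drift_coeff_eq :
    (c.tau1 + 1) / (2 * c.gam ^ 2) * c.rho2⁻¹ * c.ell ^ 2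
        + 1 / (2 * c.gam ^ 2) * c.rho2⁻¹ ^ 2 * c.ell ^ 2
        + c.rho2⁻¹ ^ 2 / 2 * c.ell ^ 2 + c.ell ^ 2 / 2
      = c.phi6 - c.ell / 2 := by
  have := hc.gam_pos
  have hcoef : (c.beta + c.gam) / (2 * c.gam ^ 3) = (c.tau1 + 1) / (2 * c.gam ^ 2) := by
    rw [beta]
    field_simp
  rw [phi6, hcoef]
  ring

end Admissible

end Params

lemma IsNetworkTriple.energy_step_le {H : Type*} [NormedAddCommGroup H] [InnerProductSpace ℝ H]
    {E K F : Module.End ℝ H} {lam : ℝ} {c : Params} (N : IsNetworkTriple E K F c.rho2 c.rho lam)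
    (hc : c.Admissible) {a G : ℝ} (ha : 0 ≤ a) (hG : 0 ≤ G) {x h D : H} (u w : H)
    (hh : ‖h‖ ≤ c.ell * ‖E x‖) (hD : ‖D‖ ≤ c.ell * (a * G)) :
    energy E F (c.tau1 + 1) (x - a • (c.beta • K (E u) + c.gam • w + h))
        (w + (a * c.gam) • K (E u) + c.gam⁻¹ • D)
      ≤ energy E F (c.tau1 + 1) x w
        - a * (c.phi1 + (11 / 20) * c.ell ^ 2 - a * c.phi2) * ‖E x‖ ^ 2
        - a * (c.phi3 - a * c.phi4) * ⟪w, F w⟫_ℝ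
        + a * (9 / 40 - c.phi5 + a * (c.phi6 - c.ell / 2)) * G ^ 2
        + a * (c.gam ^ 2 / 5) * ‖w - E w‖ ^ 2 + a * c.psi2 a * ‖x - u‖ ^ 2 := by
  have hb := hc.beta_pos.le
  have hg := hc.gam_pos
  have hgr := hc.five_lt_gam_mul_rho2.le
  have hk : 0 ≤ c.tau1 + 1 := by linarith [hc.tau1_pos]
  have hcomm : 0 ≤ a ^ 2 * (c.rho ^ 2 * c.beta ^ 2 + c.gam ^ 2 - c.rho2 * c.beta * c.gam) :=
    mul_nonneg (sq_nonneg a) (sub_nonneg.2 hc.rho2_mul_beta_mul_gam_le)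
  have hbr : 0 ≤ c.rho * c.beta * c.gam - c.rho2 * c.beta * c.gam := by
    have := hc.rho2_le
    rw [sub_nonneg]
    gcongr
  have herr : 0 ≤ a ^ 2 * (c.rho ^ 2 * c.beta ^ 2 + c.gam ^ 2
      + (c.rho - 2 * c.rho2) * c.beta * c.gam) := by
    refine mul_nonneg (sq_nonneg a) ?_
    linarith [hc.rho2_mul_beta_mul_gam_le]
  have hfirst := N.first_order_le hb hgr u w hh
  have hdrift := N.inner_inv_drift_le hg hk ha w hD
  have hdrift' := N.inner_proj_inv_drift_le hgr hc.ell_pos.le ha hG x hD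
  have hsecond := N.second_order_le hb hg.le u w hh
  have hdrift2 := N.second_order_drift_le hg hk ha u w hh hD
  rw [hc.second_order_drift_coeff_eq] at hdrift2
  have hcoef := mul_le_mul_of_nonneg_left hc.first_order_drift_coeff_le
    (mul_nonneg ha (sq_nonneg G))
  have hstep := N.energy_step_eq hg.ne' c.tau1 a x u w h D
  rw [← Params.beta] at hstep
  rw [hstep]
  simp only [Params.phi1, Params.phi2, Params.phi3, Params.phi4, Params.psi2, Params.phi7,
    Params.phi8]
  linarith [mul_le_mul_of_nonneg_left hfirst ha, mul_le_mul_of_nonneg_left hsecond (sq_nonneg a),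
    mul_nonneg hcomm (sq_nonneg ‖E x‖), mul_nonneg herr (sq_nonneg ‖x - u‖)]

end Parameters

section Stepsize

/-- The convergence rate `n^{1/3} d̃^{2/3} / T^{2/3}`. -/
def rate (n : ℕ) (dt : ℝ) (T : ℕ) : ℝ :=
  (n : ℝ) ^ (1 / 3 : ℝ) * dt ^ (2 / 3 : ℝ) / (T : ℝ) ^ (2 / 3 : ℝ)

variable {c : Params} {n T : ℕ} {dt : ℝ}

lemma rate_pos (hn : 0 < n) (hdt : 0 < dt) (hT : 0 < T) : 0 < rate n dt T := by
  rw [rate]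
  positivity

lemma rate_le_one_of_rpow_lt {Y : ℝ} (hY : 0 ≤ Y) (hdt : 0 < dt) (hT : 0 < T)
    (h : Y ^ (3 / 2 : ℝ) * (n : ℝ) ^ (1 / 2 : ℝ) * dt < T) : Y * rate n dt T ≤ 1 := by
  have hpow := Real.rpow_le_rpow (by positivity) h.le (by norm_num : (0 : ℝ) ≤ 2 / 3)
  rw [Real.mul_rpow (by positivity) hdt.le, Real.mul_rpow (by positivity) (by positivity),
    ← Real.rpow_mul hY, ← Real.rpow_mul n.cast_nonneg] at hpow
  norm_num at hpow
  rw [rate, ← mul_div_assoc, div_le_one (by positivity), ← mul_assoc]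
  exact hpow

namespace Params

lemma stepsize_pos (hτ : 0 < c.tau0) (hn : 0 < n) (hdt : 0 < dt) (hT : 0 < T) :
    0 < c.stepsize n dt T := by
  rw [stepsize]
  positivity

lemma stepsize_mul_mul_rate (hn : 0 < n) (hdt : 0 < dt) (hT : 0 < T) :
    c.stepsize n dt T * T * rate n dt T = c.tau0 := by
  have hsplit : (T : ℝ) = (T : ℝ) ^ (1 / 3 : ℝ) * (T : ℝ) ^ (2 / 3 : ℝ) := by
    rw [← Real.rpow_add (by positivity)]
    norm_num
  have : 0 < (T : ℝ) ^ (2 / 3 : ℝ) := by positivity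
  have : 0 < (T : ℝ) ^ (1 / 3 : ℝ) := by positivity
  rw [stepsize, rate]
  nth_rewrite 2 [hsplit]
  field_simp

lemma stepsize_sq_mul (hn : 0 < n) (hdt : 0 < dt) :
    c.stepsize n dt T ^ 2 * (n * dt ^ 2) = c.tau0 ^ 2 * rate n dt T := by
  have hn3 : (n : ℝ) = ((n : ℝ) ^ (1 / 3 : ℝ)) ^ 3 := by
    rw [← Real.rpow_mul_natCast n.cast_nonneg]
    norm_num
  have hdt3 : dt ^ 2 = (dt ^ (2 / 3 : ℝ)) ^ 3 := by
    rw [← Real.rpow_mul_natCast hdt.le]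
    norm_num
  have hT2 : (T : ℝ) ^ (2 / 3 : ℝ) = ((T : ℝ) ^ (1 / 3 : ℝ)) ^ 2 := by
    rw [← Real.rpow_mul_natCast T.cast_nonneg]
    norm_num
  have : 0 < (n : ℝ) ^ (1 / 3 : ℝ) := by positivity
  have : 0 < dt ^ (2 / 3 : ℝ) := by positivity
  rw [stepsize, rate, hdt3, hT2]
  nth_rewrite 2 [hn3]
  field_simp

lemma stepsize_pow_three_mul (hn : 0 < n) (hdt : 0 < dt) (hT : 0 < T) :
    c.stepsize n dt T ^ 3 * (n * dt ^ 2 * T) = c.tau0 ^ 3 := by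
  linear_combination (c.stepsize n dt T * T) * stepsize_sq_mul (c := c) (T := T) hn hdt
    + c.tau0 ^ 2 * stepsize_mul_mul_rate (c := c) hn hdt hT

namespace Admissible

variable (hc : c.Admissible) (hn : 0 < n) (hdt : 0 < dt) (hT : c.kappa3 n dt < T)
include hc hn hdt hT

lemma horizon_pos : 0 < T := by
  have := hc.kappa7_pos
  have := hc.tau0_pos
  have hpos : 0 < c.tau0 ^ 3 / ((n : ℝ) * dt ^ 2 * c.kappa7 ^ 3) := by positivity
  exact_mod_cast (hpos.trans_le (le_max_left _ _)).trans hT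

lemma stepsize_le_kappa7 : c.stepsize n dt T ≤ c.kappa7 := by
  have hT0 := hc.horizon_pos hn hdt hT
  have h7 := hc.kappa7_pos
  have hlt := (le_max_left _ _).trans_lt hT
  rw [div_lt_iff₀ (by positivity), ← stepsize_pow_three_mul hn hdt hT0] at hlt
  refine le_of_pow_le_pow_left₀ three_ne_zero h7.le ?_
  refine le_of_mul_le_mul_right ?_ (by positivity : 0 < n * dt ^ 2 * T)
  linarith

lemma psi3_mul_stepsize_sq_le :
    (1 - 2 * c.eps5) * c.psi3 * (c.stepsize n dt T ^ 2 * (n * dt ^ 2)) ≤ c.eps8 := by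
  have h8 := hc.eps8_pos
  have := mul_nonneg hc.one_sub_two_mul_eps5_nonneg hc.psi3_nonneg
  have hY : 0 ≤ (1 - 2 * c.eps5) * c.psi3 * c.tau0 ^ 2 / c.eps8 := by positivity
  have hrate := rate_le_one_of_rpow_lt hY hdt (hc.horizon_pos hn hdt hT)
    ((le_max_right _ _).trans_lt hT)
  rw [div_mul_eq_mul_div, div_le_one h8] at hrate
  rwa [stepsize_sq_mul hn hdt, ← mul_assoc]

end Admissible
end Params
end Stepsize

section LpNorm

section PiLp

variable {ι β : Type*} [Fintype ι] [SeminormedAddCommGroup β] {p q : ℝ≥0∞} [Fact (1 ≤ p)]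
  [Fact (1 ≤ q)] (x : ι → β)

lemma norm_toLp_rpow_eq_sum (hp : p ≠ ∞) :
    ‖WithLp.toLp p x‖ ^ p.toReal = ∑ i, ‖x i‖ ^ p.toReal := by
  have hp0 : 0 < p.toReal := ENNReal.toReal_pos (zero_lt_one.trans_le Fact.out).ne' hp
  rw [PiLp.norm_eq_sum hp0, ← Real.rpow_mul (by positivity), one_div_mul_cancel hp0.ne',
    Real.rpow_one]

lemma norm_toLp_le_norm_toLp (hpq : p ≤ q) : ‖WithLp.toLp q x‖ ≤ ‖WithLp.toLp p x‖ := by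
  rcases eq_or_ne q ∞ with rfl | hq
  · rw [PiLp.norm_toLp, pi_norm_le_iff_of_nonneg (norm_nonneg _)]
    exact PiLp.norm_apply_le (WithLp.toLp p x)
  have hp : p ≠ ∞ := ne_top_of_le_ne_top hq hpq
  have hp0 : 0 < p.toReal := ENNReal.toReal_pos (zero_lt_one.trans_le Fact.out).ne' hp
  have hpq' : 0 ≤ q.toReal - p.toReal := sub_nonneg.2 (ENNReal.toReal_mono hq hpq)
  rw [← Real.rpow_le_rpow_iff (norm_nonneg _) (norm_nonneg _) (by linarith : 0 < q.toReal),
    norm_toLp_rpow_eq_sum x hq]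
  calc ∑ i, ‖x i‖ ^ q.toReal
      = ∑ i, ‖x i‖ ^ p.toReal * ‖x i‖ ^ (q.toReal - p.toReal) := by
        refine Finset.sum_congr rfl fun i _ => ?_
        rw [← Real.rpow_add_of_nonneg (norm_nonneg _) hp0.le hpq', add_sub_cancel]
    _ ≤ ∑ i, ‖x i‖ ^ p.toReal * ‖WithLp.toLp p x‖ ^ (q.toReal - p.toReal) := by
        gcongr with i
        exact PiLp.norm_apply_le (WithLp.toLp p x) i
    _ = ‖WithLp.toLp p x‖ ^ q.toReal := by
        rw [← Finset.sum_mul, ← norm_toLp_rpow_eq_sum x hp,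
          ← Real.rpow_add_of_nonneg (norm_nonneg _) hp0.le hpq', add_sub_cancel]

lemma norm_toLp_le_card_rpow_mul (hpq : p ≤ q) :
    ‖WithLp.toLp p x‖
      ≤ (Fintype.card ι : ℝ) ^ ((p⁻¹).toReal - (q⁻¹).toReal) * ‖WithLp.toLp q x‖ := by
  rcases eq_or_ne p ∞ with rfl | hp
  · obtain rfl := top_le_iff.1 hpq
    simp
  have hp0 : 0 < p.toReal := ENNReal.toReal_pos (zero_lt_one.trans_le Fact.out).ne' hp
  rw [← Real.rpow_le_rpow_iff (norm_nonneg _) (by positivity) hp0, norm_toLp_rpow_eq_sum x hp,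
    Real.mul_rpow (by positivity) (norm_nonneg _), ← Real.rpow_mul (by positivity), sub_mul,
    ENNReal.toReal_inv, ENNReal.toReal_inv, inv_mul_cancel₀ hp0.ne']
  rcases eq_or_ne q ∞ with rfl | hq
  · calc ∑ i, ‖x i‖ ^ p.toReal ≤ ∑ _i : ι, ‖WithLp.toLp ∞ x‖ ^ p.toReal := by
          gcongr with i
          exact PiLp.norm_apply_le (WithLp.toLp ∞ x) i
      _ = _ := by simp
  have hq0 : 0 < q.toReal := ENNReal.toReal_pos (zero_lt_one.trans_le Fact.out).ne' hq
  have hmean := Real.rpow_sum_le_const_mul_sum_rpow_of_nonneg (f := fun i => ‖x i‖ ^ p.toReal)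
    Finset.univ ((one_le_div hp0).2 (ENNReal.toReal_mono hq hpq)) fun i _ => by positivity
  simp only [← Real.rpow_mul (norm_nonneg _), mul_div_cancel₀ _ hp0.ne'] at hmean
  rw [← norm_toLp_rpow_eq_sum x hq, Finset.card_univ] at hmean
  rw [← Real.rpow_le_rpow_iff (by positivity) (by positivity) (div_pos hq0 hp0),
    Real.mul_rpow (by positivity) (by positivity), ← Real.rpow_mul (by positivity),
    ← Real.rpow_mul (norm_nonneg _), mul_div_cancel₀ _ hp0.ne']
  convert hmean using 3
  field_simp

end PiLp

variable {d : ℕ} {p : ℝ≥0∞}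

lemma lpNorm_le_dHat_mul (hp : 1 ≤ p) (x : Vec d) : lpNorm p x ≤ dHat p d * ‖x‖ := by
  have : Fact (1 ≤ p) := ⟨hp⟩
  rw [dHat]
  split_ifs with h2
  · simpa [lpNorm] using norm_toLp_le_card_rpow_mul (WithLp.ofLp x) h2
  · simpa [lpNorm] using norm_toLp_le_norm_toLp (WithLp.ofLp x) (not_le.1 h2).le

lemma norm_le_dTilde_mul (hp : 1 ≤ p) (x : Vec d) : ‖x‖ ≤ dTilde p d * lpNorm p x := by
  have : Fact (1 ≤ p) := ⟨hp⟩
  rw [dTilde]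
  split_ifs with h2
  · simpa [lpNorm] using norm_toLp_le_norm_toLp (WithLp.ofLp x) h2
  · simpa [lpNorm] using norm_toLp_le_card_rpow_mul (WithLp.ofLp x) (not_le.1 h2).le

lemma dHat_pos (hd : 0 < d) : 0 < dHat p d := by
  rw [dHat]
  split_ifs <;> positivity

lemma dTilde_pos (hd : 0 < d) : 0 < dTilde p d := by
  rw [dTilde]
  split_ifs <;> positivity

lemma lpNorm_add_le (hp : 1 ≤ p) (x y : Vec d) : lpNorm p (x + y) ≤ lpNorm p x + lpNorm p y := by
  have : Fact (1 ≤ p) := ⟨hp⟩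
  exact norm_add_le (WithLp.toLp p (WithLp.ofLp x)) (WithLp.toLp p (WithLp.ofLp y))

lemma lpNorm_smul (hp : 1 ≤ p) (a : ℝ) (x : Vec d) : lpNorm p (a • x) = |a| * lpNorm p x := by
  have : Fact (1 ≤ p) := ⟨hp⟩
  exact norm_smul a (WithLp.toLp p (WithLp.ofLp x))

lemma lpNorm_nonneg (hp : 1 ≤ p) (x : Vec d) : 0 ≤ lpNorm p x := by
  have : Fact (1 ≤ p) := ⟨hp⟩
  exact norm_nonneg _

end LpNorm

section Mean

variable {n d : ℕ}

lemma mean_add (u w : Fin n → Vec d) : mean (u + w) = mean u + mean w := by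
  simp only [mean, Pi.add_apply, Finset.sum_add_distrib, smul_add]

lemma mean_sub (u w : Fin n → Vec d) : mean (u - w) = mean u - mean w := by
  simp only [mean, Pi.sub_apply, Finset.sum_sub_distrib, smul_sub]

lemma mean_smul (a : ℝ) (u : Fin n → Vec d) : mean (a • u) = a • mean u := by
  simp only [mean, Pi.smul_apply, ← Finset.smul_sum, smul_comm a]

lemma norm_mean_le {u : Fin n → Vec d} {b : ℝ} (hb : 0 ≤ b) (hu : ∀ i, ‖u i‖ ≤ b) :
    ‖mean u‖ ≤ b := by
  rw [mean, norm_smul, Real.norm_of_nonneg (by positivity), one_div]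
  refine inv_mul_le_of_le_mul₀ n.cast_nonneg hb ?_
  simpa using norm_sum_le_of_le Finset.univ fun i _ => hu i

lemma card_mul_norm_mean_sq_le (u : Fin n → Vec d) : n * ‖mean u‖ ^ 2 ≤ ∑ i, ‖u i‖ ^ 2 := by
  have hsum : ‖∑ i, u i‖ ^ 2 ≤ n * ∑ i, ‖u i‖ ^ 2 := by
    refine (pow_le_pow_left₀ (norm_nonneg _) (norm_sum_le _ _) 2).trans ?_
    simpa using sq_sum_le_card_mul_sum_sq (s := Finset.univ) (f := fun i => ‖u i‖)
  calc n * ‖mean u‖ ^ 2 = (n : ℝ)⁻¹ * ‖∑ i, u i‖ ^ 2 := by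
        rw [mean, norm_smul, mul_pow, Real.norm_eq_abs, sq_abs]
        field_simp
    _ ≤ ∑ i, ‖u i‖ ^ 2 :=
        inv_mul_le_of_le_mul₀ n.cast_nonneg (Finset.sum_nonneg fun i _ => sq_nonneg _) hsum

end Mean

section Smooth

lemma le_add_inner_gradient_add {V : Type*} [NormedAddCommGroup V] [InnerProductSpace ℝ V]
    [CompleteSpace V] {f : V → ℝ} (hf : Differentiable ℝ f) {l : ℝ} {x v : V}
    (hlip : ∀ y, ‖∇ f y - ∇ f x‖ ≤ l * ‖y - x‖) :
    f (x + v) ≤ f x + ⟪∇ f x, v⟫_ℝ + l / 2 * ‖v‖ ^ 2 := by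
  set F : ℝ → ℝ := fun t => f (x + t • v) - t * ⟪∇ f x, v⟫_ℝ - l / 2 * ‖v‖ ^ 2 * t ^ 2 with hF
  have hderiv : ∀ t, HasDerivAt F
      (⟪∇ f (x + t • v), v⟫_ℝ - ⟪∇ f x, v⟫_ℝ - l / 2 * ‖v‖ ^ 2 * (2 * t)) t := by
    intro t
    have hline : HasDerivAt (fun t : ℝ => x + t • v) v t := by
      simpa using ((hasDerivAt_id t).smul_const v).const_add x
    have hcomp := (hf (x + t • v)).hasFDerivAt.comp_hasDerivAt t hline
    rw [← inner_gradient_left] at hcomp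
    have hlin : HasDerivAt (fun t : ℝ => t * ⟪∇ f x, v⟫_ℝ) (⟪∇ f x, v⟫_ℝ) t := by
      simpa using (hasDerivAt_id t).mul_const (⟪∇ f x, v⟫_ℝ)
    have hsq : HasDerivAt (fun t : ℝ => l / 2 * ‖v‖ ^ 2 * t ^ 2) (l / 2 * ‖v‖ ^ 2 * (2 * t)) t := by
      simpa using ((hasDerivAt_id t).pow 2).const_mul (l / 2 * ‖v‖ ^ 2)
    exact (hcomp.sub hlin).sub hsq
  have hanti : AntitoneOn F (Set.Icc 0 1) := by
    refine antitoneOn_of_deriv_nonpos (convex_Icc 0 1)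
      (fun t _ => (hderiv t).continuousAt.continuousWithinAt)
      (fun t _ => (hderiv t).differentiableAt.differentiableWithinAt) fun t ht => ?_
    rw [interior_Icc] at ht
    rw [(hderiv t).deriv, ← inner_sub_left]
    have hgrad := hlip (x + t • v)
    rw [add_sub_cancel_left, norm_smul, Real.norm_of_nonneg ht.1.le] at hgrad
    linarith [real_inner_le_norm (∇ f (x + t • v) - ∇ f x) v,
      mul_le_mul_of_nonneg_right hgrad (norm_nonneg v)]
  have hF01 : F 1 ≤ F 0 :=
    hanti (Set.left_mem_Icc.2 zero_le_one) (Set.right_mem_Icc.2 zero_le_one) zero_le_one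
  simp only [hF, one_smul, zero_smul, add_zero] at hF01
  linarith

variable {n d : ℕ} {f : Fin n → Vec d → ℝ}

lemma hasGradientAt_globalCost (hf : ∀ i, Differentiable ℝ (f i)) (x : Vec d) :
    HasGradientAt (globalCost f) (mean fun i => ∇ (f i) x) x := by
  rw [hasGradientAt_iff_hasFDerivAt]
  have hsum : HasFDerivAt (fun x => ∑ i, f i x) (∑ i, fderiv ℝ (f i) x) x :=
    HasFDerivAt.fun_sum fun i _ => (hf i x).hasFDerivAt
  refine (hsum.const_mul (1 / (n : ℝ))).congr_fderiv ?_
  ext v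
  simp [mean]

lemma gradient_globalCost (hf : ∀ i, Differentiable ℝ (f i)) (x : Vec d) :
    ∇ (globalCost f) x = mean fun i => ∇ (f i) x :=
  (hasGradientAt_globalCost hf x).gradient

lemma norm_gradient_globalCost_sub_le {l : ℝ} (hl : 0 ≤ l) (hf : ∀ i, Differentiable ℝ (f i))
    (hlip : ∀ i x y, ‖∇ (f i) x - ∇ (f i) y‖ ≤ l * ‖x - y‖) (x y : Vec d) :
    ‖∇ (globalCost f) x - ∇ (globalCost f) y‖ ≤ l * ‖x - y‖ := by
  rw [gradient_globalCost hf, gradient_globalCost hf, ← mean_sub]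
  exact norm_mean_le (by positivity) fun i => hlip i x y

end Smooth

section Laplacian

open Matrix

section Spectrum

variable {ι : Type*} [Fintype ι] [DecidableEq ι] {M : Matrix ι ι ℝ} {μ a b : ℝ}

lemma mem_spectrum_iff_exists_mulVec_eq : μ ∈ spectrum ℝ M ↔ ∃ v ≠ 0, M *ᵥ v = μ • v := by
  rw [spectrum.mem_iff, isUnit_iff_isUnit_det, isUnit_iff_ne_zero, not_not,
    ← exists_mulVec_eq_zero_iff]
  simp only [sub_mulVec, Algebra.algebraMap_eq_smul_one, smul_mulVec, one_mulVec, sub_eq_zero,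
    eq_comm]

lemma posSemidef_sub_smul_one (hM : M.IsHermitian) (h : spectrum ℝ M ⊆ Set.Ici a) :
    (M - a • 1).PosSemidef := by
  rw [← Algebra.algebraMap_eq_smul_one, posSemidef_iff_isHermitian_and_spectrum_nonneg,
    ← spectrum.sub_singleton_eq, Algebra.algebraMap_eq_smul_one]
  refine ⟨hM.sub (isHermitian_one.smul (IsSelfAdjoint.all a)), ?_⟩
  rw [Set.sub_singleton, Set.image_subset_iff]
  exact fun μ hμ => by simpa using h hμ

lemma posSemidef_smul_one_sub (hM : M.IsHermitian) (h : spectrum ℝ M ⊆ Set.Iic b) :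
    (b • 1 - M).PosSemidef := by
  rw [← Algebra.algebraMap_eq_smul_one, posSemidef_iff_isHermitian_and_spectrum_nonneg,
    ← spectrum.singleton_sub_eq, Algebra.algebraMap_eq_smul_one]
  refine ⟨(isHermitian_one.smul (IsSelfAdjoint.all b)).sub hM, ?_⟩
  rw [Set.singleton_sub, Set.image_subset_iff]
  exact fun μ hμ => by simpa using h hμ

end Spectrum

variable {n : ℕ} {A : Matrix (Fin n) (Fin n) ℝ}

lemma laplacian_mulVec (v : Fin n → ℝ) (i : Fin n) :
    (laplacian A *ᵥ v) i = ∑ j, A i j * (v i - v j) := by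
  rw [laplacian, sub_mulVec, Pi.sub_apply, mulVec_diagonal, Finset.sum_mul]
  simp only [mulVec, dotProduct, mul_sub, Finset.sum_sub_distrib]

lemma dotProduct_laplacian_mulVec (hA : ∀ i j, A i j = A j i) (v : Fin n → ℝ) :
    v ⬝ᵥ (laplacian A *ᵥ v) = (1 / 2) * ∑ i, ∑ j, A i j * (v i - v j) ^ 2 := by
  have hsum : v ⬝ᵥ (laplacian A *ᵥ v) = ∑ i, ∑ j, A i j * (v i * (v i - v j)) := by
    simp only [dotProduct, laplacian_mulVec, Finset.mul_sum]
    exact Finset.sum_congr rfl fun i _ => Finset.sum_congr rfl fun j _ => by ring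
  have hswap : v ⬝ᵥ (laplacian A *ᵥ v) = ∑ i, ∑ j, A i j * (v j * (v j - v i)) := by
    rw [hsum, Finset.sum_comm]
    exact Finset.sum_congr rfl fun i _ => Finset.sum_congr rfl fun j _ => by rw [hA]
  have hadd : ∑ i, ∑ j, A i j * (v i - v j) ^ 2
      = ∑ i, ∑ j, A i j * (v i * (v i - v j)) + ∑ i, ∑ j, A i j * (v j * (v j - v i)) := by
    simp only [← Finset.sum_add_distrib]
    exact Finset.sum_congr rfl fun i _ => Finset.sum_congr rfl fun j _ => by ring
  rw [hadd, ← hsum, ← hswap]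
  ring

lemma isHermitian_laplacian (hA : ∀ i j, A i j = A j i) : (laplacian A).IsHermitian :=
  (isHermitian_diagonal _).sub (IsHermitian.ext fun i j => hA j i)

lemma isHermitian_avgMatrix : (avgMatrix n).IsHermitian := IsHermitian.ext fun _ _ => rfl

lemma avgMatrix_mul_self : avgMatrix n * avgMatrix n = avgMatrix n := by
  ext i j
  have : (n : ℝ) ≠ 0 := Nat.cast_ne_zero.2 i.pos.ne'
  simp only [mul_apply, avgMatrix, Finset.sum_const, Finset.card_univ, Fintype.card_fin,
    nsmul_eq_mul]
  field_simp

lemma laplacian_mul_avgMatrix : laplacian A * avgMatrix n = 0 := by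
  ext i j
  have h := laplacian_mulVec (A := A) (fun _ => 1 / (n : ℝ)) i
  simpa [mulVec, dotProduct, mul_apply, avgMatrix] using h

lemma avgMatrix_mul_laplacian (hA : ∀ i j, A i j = A j i) : avgMatrix n * laplacian A = 0 := by
  have h := congrArg conjTranspose (laplacian_mul_avgMatrix (A := A))
  rwa [conjTranspose_mul, isHermitian_laplacian hA, isHermitian_avgMatrix,
    conjTranspose_zero] at h

namespace IsConnectedNetwork

variable (hA : IsConnectedNetwork A)
include hA

lemma card_pos : 0 < n := by
  obtain ⟨i⟩ := hA.connected.nonempty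
  exact i.pos

lemma posSemidef_laplacian : (laplacian A).PosSemidef := by
  refine .of_dotProduct_mulVec_nonneg (isHermitian_laplacian hA.symm) fun v => ?_
  rw [star_trivial, dotProduct_laplacian_mulVec hA.symm]
  exact mul_nonneg (by norm_num) (Finset.sum_nonneg fun i _ => Finset.sum_nonneg fun j _ =>
    mul_nonneg (hA.nonneg i j) (sq_nonneg _))

lemma eq_of_laplacian_mulVec_eq_zero {v : Fin n → ℝ} (hv : laplacian A *ᵥ v = 0) (i j : Fin n) :
    v i = v j := by
  have hterm : ∀ i j, 0 ≤ A i j * (v i - v j) ^ 2 := fun i j =>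
    mul_nonneg (hA.nonneg i j) (sq_nonneg _)
  have hsum : ∑ i, ∑ j, A i j * (v i - v j) ^ 2 = 0 := by
    have h := dotProduct_laplacian_mulVec hA.symm v
    rw [hv, dotProduct_zero] at h
    linarith
  have hedge : ∀ i j, 0 < A i j → v i = v j := by
    intro i j hij
    rw [Fintype.sum_eq_zero_iff_of_nonneg fun i => Finset.sum_nonneg fun j _ => hterm i j] at hsum
    have hrow := congrFun hsum i
    rw [Pi.zero_apply, Fintype.sum_eq_zero_iff_of_nonneg (hterm i)] at hrow
    have hij0 := (mul_eq_zero.1 (congrFun hrow j)).resolve_left hij.ne'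
    exact sub_eq_zero.1 (sq_eq_zero_iff.1 hij0)
  obtain ⟨w⟩ := hA.connected.preconnected i j
  induction w with
  | nil => rfl
  | cons hadj _ ih =>
    rw [SimpleGraph.fromRel_adj] at hadj
    refine Eq.trans ?_ ih
    rcases hadj.2 with h | h
    · exact hedge _ _ h
    · exact (hedge _ _ h).symm

lemma eq_zero_of_laplacian_mulVec_eq_zero {v : Fin n → ℝ} (hL : laplacian A *ᵥ v = 0)
    (hJ : avgMatrix n *ᵥ v = 0) : v = 0 := by
  have : (n : ℝ) ≠ 0 := Nat.cast_ne_zero.2 hA.card_pos.ne'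
  ext i
  have hi := congrFun hJ i
  simp only [mulVec, dotProduct, avgMatrix, Pi.zero_apply,
    hA.eq_of_laplacian_mulVec_eq_zero hL _ i] at hi
  simpa [this] using hi

lemma mem_spectrum_shift {μ lam : ℝ} (h : μ ∈ spectrum ℝ (laplacian A + lam • avgMatrix n)) :
    μ = lam ∨ μ ∈ spectrum ℝ (laplacian A) ∧ 0 < μ := by
  obtain ⟨v, hv, hvμ⟩ := mem_spectrum_iff_exists_mulVec_eq.1 h
  have hJ : (μ - lam) • (avgMatrix n *ᵥ v) = 0 := by
    have h := congrArg (avgMatrix n *ᵥ ·) hvμ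
    simp only [mulVec_mulVec, mul_add, avgMatrix_mul_laplacian hA.symm, mul_smul_comm,
      avgMatrix_mul_self, zero_add, mulVec_smul, smul_mulVec] at h
    rw [sub_smul, h, sub_self]
  refine (smul_eq_zero.1 hJ).imp sub_eq_zero.1 fun hJ0 => ?_
  rw [add_mulVec, smul_mulVec, hJ0, smul_zero, add_zero] at hvμ
  have hmem := mem_spectrum_iff_exists_mulVec_eq.2 ⟨v, hv, hvμ⟩
  have hnonneg := (posSemidef_iff_isHermitian_and_spectrum_nonneg.1 hA.posSemidef_laplacian).2 hmem
  refine ⟨hmem, lt_of_le_of_ne hnonneg ?_⟩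
  rintro rfl
  exact hv (hA.eq_zero_of_laplacian_mulVec_eq_zero (by rw [hvμ, zero_smul]) hJ0)

lemma spectrum_shift_subset {rho rho2 lam : ℝ}
    (hrho : IsGreatest ((fun μ : ℝ => |μ|) '' spectrum ℝ (laplacian A)) rho)
    (hrho2 : IsLeast {μ : ℝ | μ ∈ spectrum ℝ (laplacian A) ∧ 0 < μ} rho2)
    (hlam : lam ∈ Set.Icc rho2 rho) :
    spectrum ℝ (laplacian A + lam • avgMatrix n) ⊆ Set.Icc rho2 rho := by
  intro μ hμ
  rcases hA.mem_spectrum_shift hμ with rfl | h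
  · exact hlam
  · exact ⟨hrho2.2 h, (le_abs_self μ).trans (hrho.2 ⟨μ, h.1, rfl⟩)⟩

end IsConnectedNetwork
end Laplacian

section Stacked

/-- Stacked vectors of all agents with their Euclidean norm. -/
abbrev Stacked (n d : ℕ) : Type := PiLp 2 (fun _ : Fin n => Vec d)

variable {n d : ℕ}

/-- The representation `M ↦ M ⊗ I_d` of matrices by operators on stacked vectors. -/
def matOp : Matrix (Fin n) (Fin n) ℝ →ₐ[ℝ] Module.End ℝ (Stacked n d) :=
  AlgHom.ofLinearMap
    (LinearMap.mk₂ ℝ (fun M u => WithLp.toLp 2 (applyMat M (WithLp.ofLp u)))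
      (fun M N u => by ext i : 1; simp [applyMat, add_smul, Finset.sum_add_distrib])
      (fun a M u => by ext i : 1; simp [applyMat, Finset.smul_sum, smul_smul])
      (fun M u w => by ext i : 1; simp [applyMat, Finset.sum_add_distrib])
      (fun a M u => by ext i : 1; simp [applyMat, Finset.smul_sum, smul_comm a]))
    (by ext u i : 2; simp [applyMat, Matrix.one_apply])
    (fun M N => by
      ext u i : 2
      simp only [LinearMap.mk₂_apply, applyMat, Module.End.mul_apply, Matrix.mul_apply,
        Finset.sum_smul, Finset.smul_sum, smul_smul]
      exact Finset.sum_comm)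

lemma matOp_apply (M : Matrix (Fin n) (Fin n) ℝ) (u : Stacked n d) (i : Fin n) :
    matOp M u i = ∑ j, M i j • u j := rfl

lemma inner_matOp (M : Matrix (Fin n) (Fin n) ℝ) (u w : Stacked n d) :
    ⟪u, matOp M w⟫_ℝ = bilin M (WithLp.ofLp u) (WithLp.ofLp w) := by
  rw [PiLp.inner_apply]
  simp only [matOp_apply, inner_sum, real_inner_smul_right, bilin]

lemma inner_matOp_conjTranspose_left (M : Matrix (Fin n) (Fin n) ℝ) (u w : Stacked n d) :
    ⟪matOp M.conjTranspose u, w⟫_ℝ = ⟪u, matOp M w⟫_ℝ := by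
  rw [real_inner_comm, inner_matOp, inner_matOp, bilin, bilin, Finset.sum_comm]
  simp only [Matrix.conjTranspose_apply, star_trivial, real_inner_comm]

lemma isSymmetric_matOp {M : Matrix (Fin n) (Fin n) ℝ} (hM : M.IsHermitian) :
    (matOp M : Module.End ℝ (Stacked n d)).IsSymmetric := fun u w => by
  rw [← inner_matOp_conjTranspose_left, hM]

open scoped MatrixOrder Matrix.Norms.L2Operator in
lemma isPositive_matOp {M : Matrix (Fin n) (Fin n) ℝ} (hM : M.PosSemidef) :
    (matOp M : Module.End ℝ (Stacked n d)).IsPositive := by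
  refine ⟨isSymmetric_matOp hM.isHermitian, fun u => ?_⟩
  obtain ⟨B, rfl⟩ := CStarAlgebra.nonneg_iff_eq_star_mul_self.1 hM.nonneg
  rw [Matrix.star_eq_conjTranspose, map_mul, Module.End.mul_apply, inner_matOp_conjTranspose_left]
  exact real_inner_self_nonneg (x := matOp B u)

lemma isSymmetricProjection_matOp_matE :
    (matOp (matE n) : Module.End ℝ (Stacked n d)).IsSymmetricProjection := by
  have hidem : IsIdempotentElem (avgMatrix n) := avgMatrix_mul_self
  exact ⟨hidem.one_sub.map matOp, isSymmetric_matOp (Matrix.isHermitian_one.sub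
    isHermitian_avgMatrix)⟩

theorem IsConnectedNetwork.isNetworkTriple {A : Matrix (Fin n) (Fin n) ℝ} {rho rho2 lam : ℝ}
    (hA : IsConnectedNetwork A)
    (hrho : IsGreatest ((fun μ : ℝ => |μ|) '' spectrum ℝ (laplacian A)) rho)
    (hrho2 : IsLeast {μ : ℝ | μ ∈ spectrum ℝ (laplacian A) ∧ 0 < μ} rho2)
    (hlam : lam ∈ Set.Icc rho2 rho) :
    IsNetworkTriple (H := Stacked n d) (matOp (matE n))
      (matOp (laplacian A + lam • avgMatrix n)) (matOp (matF A lam)) rho2 rho lam := by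
  have hspec := hA.spectrum_shift_subset hrho hrho2 hlam
  have hherm : (laplacian A + lam • avgMatrix n).IsHermitian :=
    (isHermitian_laplacian hA.symm).add (isHermitian_avgMatrix.smul (IsSelfAdjoint.all lam))
  have hdet : IsUnit (laplacian A + lam • avgMatrix n).det := by
    rw [← Matrix.isUnit_iff_isUnit_det, ← spectrum.zero_notMem_iff ℝ]
    exact fun h0 => (hspec h0).1.not_gt hrho2.1.2
  have hcomm : Commute (matE n) (laplacian A + lam • avgMatrix n) := by
    refine (Commute.one_left _).sub_left (.add_right ?_ (Commute.refl _ |>.smul_right lam))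
    rw [commute_iff_eq, avgMatrix_mul_laplacian hA.symm, laplacian_mul_avgMatrix]
  exact
    { lo_pos := hrho2.1.2
      lo_le := hlam.1
      le_hi := hlam.2
      proj := isSymmetricProjection_matOp_matE
      commute := hcomm.map matOp
      right_inv := by rw [← map_mul, matF, Matrix.mul_nonsing_inv _ hdet, map_one]
      left_inv := by rw [← map_mul, matF, Matrix.nonsing_inv_mul _ hdet, map_one]
      smul_one_le := by
        rw [LinearMap.le_def, ← map_one matOp, ← map_smul, ← map_sub]
        exact isPositive_matOp (posSemidef_sub_smul_one hherm fun μ hμ => (hspec hμ).1)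
      le_smul_one := by
        rw [LinearMap.le_def, ← map_one matOp, ← map_smul, ← map_sub]
        exact isPositive_matOp (posSemidef_smul_one_sub hherm fun μ hμ => (hspec hμ).2)
      mul_one_sub := by
        rw [← map_one matOp, ← map_sub, ← map_mul, ← map_smul, matE, sub_sub_cancel, add_mul,
          laplacian_mul_avgMatrix, smul_mul_assoc, avgMatrix_mul_self, zero_add] }

end Stacked

section Iteration

lemma norm_add_sq_le_two_mul {V : Type*} [SeminormedAddCommGroup V] (a b : V) :
    ‖a + b‖ ^ 2 ≤ 2 * (‖a‖ ^ 2 + ‖b‖ ^ 2) :=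
  (pow_le_pow_left₀ (norm_nonneg _) (norm_add_le a b) 2).trans (add_sq_le ..)

lemma IsNetworkTriple.norm_direction_sq_le {H : Type*} [NormedAddCommGroup H]
    [InnerProductSpace ℝ H] {E K F : Module.End ℝ H} {lo hi lam : ℝ}
    (N : IsNetworkTriple E K F lo hi lam) {l : ℝ} (b g : ℝ) {x h : H} (u w : H)
    (hh : ‖h‖ ≤ l * ‖E x‖) :
    ‖b • K (E u) + g • w + h‖ ^ 2
      ≤ 4 * ((b ^ 2 * hi ^ 2 + l ^ 2) * ‖E x‖ ^ 2 + g ^ 2 * hi * ⟪w, F w⟫_ℝ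
        + b ^ 2 * hi ^ 2 * ‖x - u‖ ^ 2) := by
  have hsplit : b • K (E u) + g • w + h
      = (b • K (E x) + h) + (g • w + b • K (E (u - x))) := by
    simp only [map_sub, smul_sub]
    abel
  have hx : ‖b • K (E x)‖ ^ 2 ≤ b ^ 2 * (hi ^ 2 * ‖E x‖ ^ 2) := by
    rw [norm_smul, mul_pow, Real.norm_eq_abs, sq_abs]
    gcongr
    exact N.norm_apply_sq_le _
  have hu : ‖b • K (E (u - x))‖ ^ 2 ≤ b ^ 2 * (hi ^ 2 * ‖x - u‖ ^ 2) := by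
    rw [norm_smul, mul_pow, Real.norm_eq_abs, sq_abs, norm_sub_rev x]
    gcongr
    refine (N.norm_apply_sq_le _).trans ?_
    gcongr
    exact norm_proj_le N.proj _
  have hw : ‖g • w‖ ^ 2 ≤ g ^ 2 * (hi * ⟪w, F w⟫_ℝ) := by
    rw [norm_smul, mul_pow, Real.norm_eq_abs, sq_abs]
    gcongr
    exact N.norm_sq_le_inner_inv w
  have hh2 : ‖h‖ ^ 2 ≤ l ^ 2 * ‖E x‖ ^ 2 := by
    rw [← mul_pow]
    gcongr
  rw [hsplit]
  linarith [norm_add_sq_le_two_mul (b • K (E x) + h) (g • w + b • K (E (u - x))),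
    norm_add_sq_le_two_mul (b • K (E x)) h, norm_add_sq_le_two_mul (g • w) (b • K (E (u - x)))]

variable {n d : ℕ} {c : Params} {A : Matrix (Fin n) (Fin n) ℝ} {lam : ℝ}
  {f : Fin n → Vec d → ℝ} {x v xhat : Fin n → Vec d} {z : State n d} {α : ℝ}

lemma mean_applyMat_laplacian (hA : ∀ i j, A i j = A j i) (u : Fin n → Vec d) :
    mean (applyMat (laplacian A) u) = 0 := by
  have hcol : ∀ j, ∑ i, laplacian A i j = 0 := fun j => by
    have hrow := laplacian_mulVec (A := A) (fun _ => 1) j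
    simp only [Matrix.mulVec, dotProduct, mul_one, sub_self, mul_zero,
      Finset.sum_const_zero] at hrow
    rw [← hrow]
    exact Finset.sum_congr rfl fun i _ => (isHermitian_laplacian hA).apply i j ▸ rfl
  simp only [mean, applyMat]
  rw [Finset.sum_comm]
  simp only [← Finset.sum_smul, hcol, zero_smul, Finset.sum_const_zero, smul_zero]

lemma matOp_matE_apply (u : Stacked n d) (i : Fin n) :
    matOp (matE n) u i = u i - mean (WithLp.ofLp u) := by
  rw [matE, map_sub, map_one, LinearMap.sub_apply, PiLp.sub_apply, matOp_apply, mean,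
    Finset.smul_sum]
  rfl

lemma norm_matOp_matE_sq (x : Fin n → Vec d) :
    ‖matOp (matE n) (WithLp.toLp 2 x)‖ ^ 2 = ∑ i, ‖x i - mean x‖ ^ 2 := by
  simp only [PiLp.norm_sq_eq_of_L2, matOp_matE_apply]

lemma matOp_shift_matE (A : Matrix (Fin n) (Fin n) ℝ) (lam : ℝ) (u : Stacked n d) :
    matOp (laplacian A + lam • avgMatrix n) (matOp (matE n) u) = matOp (laplacian A) u := by
  rw [← Module.End.mul_apply, ← map_mul, matE, mul_sub, mul_one, add_mul,
    laplacian_mul_avgMatrix, smul_mul_assoc, avgMatrix_mul_self, zero_add, add_sub_cancel_right]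

/-- The stacked dual error `w = v + ∇f(x̄) / γ`. -/
def dualError (c : Params) (f : Fin n → Vec d → ℝ) (x v : Fin n → Vec d) : Stacked n d :=
  WithLp.toLp 2 fun i => v i + (1 / c.gam) • ∇ (f i) (mean x)

/-- The stacked deviation of the local gradients from those at the average. -/
def gradError (f : Fin n → Vec d → ℝ) (x : Fin n → Vec d) : Stacked n d :=
  WithLp.toLp 2 fun i => ∇ (f i) (x i) - ∇ (f i) (mean x)

/-- The stacked change of the local gradients between two common points. -/
def gradDrift (f : Fin n → Vec d → ℝ) (y y' : Vec d) : Stacked n d :=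
  WithLp.toLp 2 fun i => ∇ (f i) y' - ∇ (f i) y

/-- The per-iteration decrease of the Lyapunov function, up to the stepsize. -/
def progress (c : Params) (f : Fin n → Vec d → ℝ) (x : Fin n → Vec d) : ℝ :=
  3 / 10 * n * ‖∇ (globalCost f) (mean x)‖ ^ 2 + c.ell ^ 2 / 20 * ∑ i, ‖x i - mean x‖ ^ 2

/-- The iteration in which the agents' estimates become `x̂ = xhat`; the invariant `y = L x̂` of the
algorithm then determines `y`. -/
def State.advance (c : Params) (A : Matrix (Fin n) (Fin n) ℝ) (α : ℝ) (f : Fin n → Vec d → ℝ)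
    (z : State n d) (xhat : Fin n → Vec d) : State n d :=
  z.update c α f xhat (applyMat (laplacian A) xhat)

/-- The assumptions on the parameters, the network and the cost functions, the first two in the
form in which they enter the convergence proof. -/
structure IsProblem (c : Params) (A : Matrix (Fin n) (Fin n) ℝ) (lam : ℝ)
    (f : Fin n → Vec d → ℝ) : Prop where
  admissible : c.Admissible
  network : IsConnectedNetwork A
  triple : IsNetworkTriple (H := Stacked n d) (matOp (matE n))
    (matOp (laplacian A + lam • avgMatrix n)) (matOp (matF A lam)) c.rho2 c.rho lam
  differentiable : ∀ i, Differentiable ℝ (f i)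
  lipschitz : ∀ i x y, ‖∇ (f i) x - ∇ (f i) y‖ ≤ c.ell * ‖x - y‖

lemma lyapunov_eq (hgam : c.gam ≠ 0) (flow : ℝ) (x v : Fin n → Vec d) :
    c.lyapunov A lam f flow x v
      = energy (matOp (matE n)) (matOp (matF A lam)) (c.tau1 + 1) (WithLp.toLp 2 x)
          (dualError c f x v) + n * (globalCost f (mean x) - flow) := by
  have hweight : (c.beta + c.gam) / c.gam = c.tau1 + 1 := by
    rw [Params.beta]
    field_simp
  rw [energy, inner_matOp, inner_matOp, ← Module.End.mul_apply, ← map_mul, inner_matOp,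
    Params.lyapunov, hweight]
  rfl

lemma norm_gradError_le {l : ℝ} (hl : 0 ≤ l)
    (hlip : ∀ i x y, ‖∇ (f i) x - ∇ (f i) y‖ ≤ l * ‖x - y‖) (x : Fin n → Vec d) :
    ‖gradError f x‖ ≤ l * ‖matOp (matE n) (WithLp.toLp 2 x)‖ := by
  refine le_of_sq_le_sq ?_ (by positivity)
  rw [mul_pow, norm_matOp_matE_sq, PiLp.norm_sq_eq_of_L2, Finset.mul_sum]
  refine Finset.sum_le_sum fun i _ => ?_
  rw [← mul_pow]
  exact pow_le_pow_left₀ (norm_nonneg _) (hlip i _ _) 2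

lemma norm_gradDrift_le {l : ℝ} (hl : 0 ≤ l)
    (hlip : ∀ i x y, ‖∇ (f i) x - ∇ (f i) y‖ ≤ l * ‖x - y‖) (y y' : Vec d) :
    ‖gradDrift f y y'‖ ≤ l * (√n * ‖y' - y‖) := by
  refine le_of_sq_le_sq ?_ (by positivity)
  rw [PiLp.norm_sq_eq_of_L2]
  calc ∑ i, ‖∇ (f i) y' - ∇ (f i) y‖ ^ 2 ≤ ∑ _i : Fin n, (l * ‖y' - y‖) ^ 2 :=
        Finset.sum_le_sum fun i _ => pow_le_pow_left₀ (norm_nonneg _) (hlip i _ _) 2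
    _ = (l * (√n * ‖y' - y‖)) ^ 2 := by
        simp only [Finset.sum_const, Finset.card_univ, Fintype.card_fin, nsmul_eq_mul, mul_pow,
          Real.sq_sqrt n.cast_nonneg]
        ring

lemma norm_sq_dualError_sub (hgam : c.gam ≠ 0) (hf : ∀ i, Differentiable ℝ (f i))
    (hv : mean v = 0) :
    c.gam ^ 2 * ‖dualError c f x v - matOp (matE n) (dualError c f x v)‖ ^ 2
      = n * ‖∇ (globalCost f) (mean x)‖ ^ 2 := by
  have hmean : mean (WithLp.ofLp (dualError c f x v))
      = (1 / c.gam) • ∇ (globalCost f) (mean x) := by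
    change mean (v + (1 / c.gam) • fun i => ∇ (f i) (mean x)) = _
    rw [mean_add, mean_smul, hv, zero_add, gradient_globalCost hf]
  rw [PiLp.norm_sq_eq_of_L2]
  simp only [PiLp.sub_apply, matOp_matE_apply, sub_sub_cancel, Finset.sum_const,
    Finset.card_univ, Fintype.card_fin, nsmul_eq_mul, hmean, norm_smul, mul_pow,
    Real.norm_eq_abs, sq_abs]
  field_simp

lemma toLp_advance_x (hgam : c.gam ≠ 0) (lam α : ℝ) (z : State n d) (xhat : Fin n → Vec d) :
    WithLp.toLp 2 (z.advance c A α f xhat).x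
      = WithLp.toLp 2 z.x - α • (c.beta • matOp (laplacian A + lam • avgMatrix n)
          (matOp (matE n) (WithLp.toLp 2 xhat)) + c.gam • dualError c f z.x z.v
          + gradError f z.x) := by
  rw [matOp_shift_matE]
  ext i : 1
  simp only [State.advance, State.update, PiLp.sub_apply, PiLp.smul_apply, PiLp.add_apply,
    dualError, gradError, matOp_apply, applyMat, smul_add, smul_sub, smul_smul,
    mul_one_div_cancel hgam, mul_assoc, mul_one]
  abel

lemma dualError_advance (lam α : ℝ) (z : State n d) (xhat x' : Fin n → Vec d) :
    dualError c f x' (z.advance c A α f xhat).v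
      = dualError c f z.x z.v + (α * c.gam) • matOp (laplacian A + lam • avgMatrix n)
          (matOp (matE n) (WithLp.toLp 2 xhat)) + c.gam⁻¹ • gradDrift f (mean z.x) (mean x') := by
  rw [matOp_shift_matE]
  ext i : 1
  simp only [State.advance, State.update, PiLp.smul_apply, PiLp.add_apply, dualError, gradDrift,
    matOp_apply, applyMat, smul_sub, one_div]
  abel

lemma mean_advance_x (hA : ∀ i j, A i j = A j i) (hv : mean z.v = 0) :
    mean (z.advance c A α f xhat).x = mean z.x - α • mean fun i => ∇ (f i) (z.x i) := by
  change mean (z.x - α • (c.beta • applyMat (laplacian A) xhat + c.gam • z.v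
    + fun i => ∇ (f i) (z.x i))) = _
  rw [mean_sub, mean_smul, mean_add, mean_add, mean_smul, mean_smul, hv,
    mean_applyMat_laplacian hA, smul_zero, smul_zero, add_zero, zero_add]

lemma mean_advance_v (hA : ∀ i j, A i j = A j i) (hv : mean z.v = 0) :
    mean (z.advance c A α f xhat).v = 0 := by
  change mean (z.v + (α * c.gam) • applyMat (laplacian A) xhat) = 0
  rw [mean_add, mean_smul, hv, mean_applyMat_laplacian hA, smul_zero, add_zero]

namespace IsProblem

variable (P : IsProblem c A lam f)
include P

lemma norm_mean_gradient_sub_sq_le (x : Fin n → Vec d) :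
    n * ‖(mean fun i => ∇ (f i) (x i)) - ∇ (globalCost f) (mean x)‖ ^ 2
      ≤ c.ell ^ 2 * ∑ i, ‖x i - mean x‖ ^ 2 := by
  rw [gradient_globalCost P.differentiable, ← mean_sub, Finset.mul_sum]
  refine (card_mul_norm_mean_sq_le _).trans (Finset.sum_le_sum fun i _ => ?_)
  rw [← mul_pow]
  exact pow_le_pow_left₀ (norm_nonneg _) (P.lipschitz i _ _) 2

lemma globalCost_advance_le (hα : 0 ≤ α) (hv : mean z.v = 0) :
    n * globalCost f (mean (z.advance c A α f xhat).x)
      ≤ n * globalCost f (mean z.x)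
        + α / 2 * (c.ell ^ 2 * ∑ i, ‖z.x i - mean z.x‖ ^ 2
          - n * ‖mean fun i => ∇ (f i) (z.x i)‖ ^ 2 - n * ‖∇ (globalCost f) (mean z.x)‖ ^ 2)
        + c.ell / 2 * α ^ 2 * (n * ‖mean fun i => ∇ (f i) (z.x i)‖ ^ 2) := by
  have hcross := P.norm_mean_gradient_sub_sq_le z.x
  rw [mean_advance_x P.network.symm hv]
  set g : Vec d := mean fun i => ∇ (f i) (z.x i)
  have hdescent := le_add_inner_gradient_add
    (fun x => (hasGradientAt_globalCost P.differentiable x).differentiableAt) (v := -(α • g))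
    fun y => norm_gradient_globalCost_sub_le P.admissible.ell_pos.le P.differentiable P.lipschitz y
      (mean z.x)
  rw [← sub_eq_add_neg, inner_neg_right, real_inner_smul_right, norm_neg, norm_smul, mul_pow,
    Real.norm_eq_abs, sq_abs] at hdescent
  rw [norm_sub_sq_real, real_inner_comm] at hcross
  linarith [mul_le_mul_of_nonneg_left hdescent n.cast_nonneg,
    mul_le_mul_of_nonneg_left hcross hα]

lemma energy_advance_le (hα : 0 ≤ α) (hα7 : α ≤ c.kappa7) (hv : mean z.v = 0) :
    energy (matOp (matE n)) (matOp (matF A lam)) (c.tau1 + 1)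
        (WithLp.toLp 2 (z.advance c A α f xhat).x)
        (dualError c f (z.advance c A α f xhat).x (z.advance c A α f xhat).v)
      ≤ energy (matOp (matE n)) (matOp (matF A lam)) (c.tau1 + 1) (WithLp.toLp 2 z.x)
          (dualError c f z.x z.v)
        - α * (11 / 20 * c.ell ^ 2) * ∑ i, ‖z.x i - mean z.x‖ ^ 2
        + α * (9 / 40 - α * c.ell / 2) * (n * ‖mean fun i => ∇ (f i) (z.x i)‖ ^ 2)
        + α / 5 * (n * ‖∇ (globalCost f) (mean z.x)‖ ^ 2)
        + α * c.psi2 α * ∑ i, ‖z.x i - xhat i‖ ^ 2 := by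
  have hc := P.admissible
  set g : Vec d := mean fun i => ∇ (f i) (z.x i)
  have hdrift : ‖gradDrift f (mean z.x) (mean (z.advance c A α f xhat).x)‖
      ≤ c.ell * (α * (√n * ‖g‖)) := by
    refine (norm_gradDrift_le hc.ell_pos.le P.lipschitz _ _).trans_eq ?_
    rw [mean_advance_x P.network.symm hv, sub_sub_cancel_left, norm_neg, norm_smul,
      Real.norm_of_nonneg hα]
    ring
  have hstep := P.triple.energy_step_le hc hα (by positivity) (WithLp.toLp 2 xhat)
    (dualError c f z.x z.v) (norm_gradError_le hc.ell_pos.le P.lipschitz z.x) hdrift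
  have herror : ‖(WithLp.toLp 2 z.x - WithLp.toLp 2 xhat : Stacked n d)‖ ^ 2
      = ∑ i, ‖z.x i - xhat i‖ ^ 2 := PiLp.norm_sq_eq_of_L2 _ _
  have hmeanPart := norm_sq_dualError_sub (x := z.x) hc.gam_pos.ne' P.differentiable hv
  rw [← toLp_advance_x hc.gam_pos.ne', ← dualError_advance, mul_pow, Real.sq_sqrt n.cast_nonneg,
    norm_matOp_matE_sq, herror] at hstep
  have hphi2 := mul_nonneg (mul_nonneg hα (sub_nonneg.2 (hc.mul_phi2_le hα7)))
    (Finset.sum_nonneg fun i (_ : i ∈ Finset.univ) => sq_nonneg ‖z.x i - mean z.x‖)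
  have hphi4 := mul_nonneg (mul_nonneg hα (sub_nonneg.2 (hc.mul_phi4_le hα7)))
    (P.triple.inner_inv_nonneg (dualError c f z.x z.v))
  have hphi6 := mul_nonneg (mul_nonneg hα (sub_nonneg.2 (hc.mul_phi6_le hα7)))
    (mul_nonneg n.cast_nonneg (sq_nonneg ‖g‖))
  linarith [congrArg (α / 5 * ·) hmeanPart]

theorem lyapunov_advance_le (hα : 0 ≤ α) (hα7 : α ≤ c.kappa7) (hv : mean z.v = 0) (flow : ℝ) :
    c.lyapunov A lam f flow (z.advance c A α f xhat).x (z.advance c A α f xhat).v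
      ≤ c.lyapunov A lam f flow z.x z.v - α * progress c f z.x
        + α * c.psi2 α * ∑ i, ‖z.x i - xhat i‖ ^ 2 := by
  have henergy := P.energy_advance_le (xhat := xhat) hα hα7 hv
  have hcost := P.globalCost_advance_le (xhat := xhat) hα hv
  have hgrad : 0 ≤ α * (n * ‖mean fun i => ∇ (f i) (z.x i)‖ ^ 2) := by positivity
  have hgam := P.admissible.gam_pos.ne'
  rw [lyapunov_eq hgam, lyapunov_eq hgam, progress]
  linarith

end IsProblem
end Iteration

section Compression

variable {d : ℕ} {p : ℝ≥0∞} {c : Params}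

lemma lpNorm_sub_compress_le (hc : c.Admissible) (hp : 1 ≤ p) {comp : Vec d → Vec d}
    (hcomp : LocallyBounded p c.C c.r c.del comp) {s : ℝ} (hs : 0 < s) {u : Vec d}
    (hu : lpNorm p u ≤ c.C * s) :
    lpNorm p (u - (c.om * s) • comp ((1 / s) • u)) ≤ c.C * s * (1 - c.om * c.r * c.del) := by
  have hr := hc.r_pos
  have hom := hc.om_pos
  have homr : 0 ≤ 1 - c.om * c.r := sub_nonneg.2 hc.om_mul_r_le
  have hscaled : lpNorm p ((1 / s) • u) ≤ c.C := by
    rw [lpNorm_smul hp, abs_of_pos (by positivity), one_div, inv_mul_le_iff₀ hs]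
    linarith
  have hsplit : u - (c.om * s) • comp ((1 / s) • u)
      = (1 - c.om * c.r) • u
        + (-(c.om * c.r * s)) • ((1 / c.r) • comp ((1 / s) • u) - (1 / s) • u) := by
    match_scalars <;> field_simp
    ring
  calc lpNorm p (u - (c.om * s) • comp ((1 / s) • u))
      ≤ (1 - c.om * c.r) * lpNorm p u
        + c.om * c.r * s * lpNorm p ((1 / c.r) • comp ((1 / s) • u) - (1 / s) • u) := by
        rw [hsplit]
        refine (lpNorm_add_le hp _ _).trans_eq ?_
        rw [lpNorm_smul hp, lpNorm_smul hp, abs_of_nonneg homr, abs_neg,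
          abs_of_pos (by positivity)]
    _ ≤ (1 - c.om * c.r) * (c.C * s) + c.om * c.r * s * (c.C * (1 - c.del)) := by
        gcongr
        exact hcomp _ hscaled
    _ = c.C * s * (1 - c.om * c.r * c.del) := by ring

lemma Params.Admissible.one_sub_om_mul_r_mul_del_sq_le (hc : c.Admissible) :
    (1 - c.om * c.r * c.del) ^ 2 ≤ 1 - 2 * c.eps5 := by
  have : 0 ≤ c.om * c.r * (1 - c.om * c.r) * c.del ^ 2 :=
    mul_nonneg (mul_nonneg (mul_pos hc.om_pos hc.r_pos).le (sub_nonneg.2 hc.om_mul_r_le))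
      (sq_nonneg _)
  rw [Params.eps5]
  linarith

lemma lpNorm_sub_compress_sq_le (hc : c.Admissible) (hp : 1 ≤ p) {comp : Vec d → Vec d}
    (hcomp : LocallyBounded p c.C c.r c.del comp) {s : ℝ} (hs : 0 < s) {u : Vec d}
    (hu : lpNorm p u ^ 2 ≤ c.C ^ 2 * s ^ 2) :
    lpNorm p (u - (c.om * s) • comp ((1 / s) • u)) ^ 2
      ≤ c.C ^ 2 * s ^ 2 * (1 - 2 * c.eps5) := by
  have hC := hc.C_pos
  have hle : lpNorm p u ≤ c.C * s := le_of_sq_le_sq (by rwa [mul_pow]) (by positivity)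
  calc lpNorm p (u - (c.om * s) • comp ((1 / s) • u)) ^ 2
      ≤ (c.C * s * (1 - c.om * c.r * c.del)) ^ 2 :=
        pow_le_pow_left₀ (lpNorm_nonneg hp _) (lpNorm_sub_compress_le hc hp hcomp hs hle) 2
    _ = c.C ^ 2 * s ^ 2 * (1 - c.om * c.r * c.del) ^ 2 := by ring
    _ ≤ c.C ^ 2 * s ^ 2 * (1 - 2 * c.eps5) := by
        gcongr
        exact hc.one_sub_om_mul_r_mul_del_sq_le

lemma lpNorm_add_sq_le (hp : 1 ≤ p) {a : ℝ} (ha : 0 < a) (u e : Vec d) :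
    lpNorm p (u + e) ^ 2 ≤ (1 + a⁻¹) * dHat p d ^ 2 * ‖u‖ ^ 2 + (1 + a) * lpNorm p e ^ 2 := by
  have hu : lpNorm p u ^ 2 ≤ dHat p d ^ 2 * ‖u‖ ^ 2 := by
    rw [← mul_pow]
    exact pow_le_pow_left₀ (lpNorm_nonneg hp u) (lpNorm_le_dHat_mul hp u) 2
  calc lpNorm p (u + e) ^ 2 ≤ (lpNorm p u + lpNorm p e) ^ 2 :=
        pow_le_pow_left₀ (lpNorm_nonneg hp _) (lpNorm_add_le hp u e) 2
    _ = lpNorm p u ^ 2 + 2 * lpNorm p u * lpNorm p e + lpNorm p e ^ 2 := add_sq _ _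
    _ ≤ (1 + a⁻¹) * lpNorm p u ^ 2 + (1 + a) * lpNorm p e ^ 2 := by
        linarith [two_mul_le_add_mul_sq (a := lpNorm p e) (b := lpNorm p u) ha]
    _ ≤ (1 + a⁻¹) * dHat p d ^ 2 * ‖u‖ ^ 2 + (1 + a) * lpNorm p e ^ 2 := by
        rw [mul_assoc _ (dHat p d ^ 2)]
        gcongr

lemma sum_norm_sq_le_of_lpNorm_sq_le {n : ℕ} (hp : 1 ≤ p) {b : ℝ} {e : Fin n → Vec d}
    (he : ∀ i, lpNorm p (e i) ^ 2 ≤ b) : ∑ i, ‖e i‖ ^ 2 ≤ n * dTilde p d ^ 2 * b := by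
  have hterm : ∀ i, ‖e i‖ ^ 2 ≤ dTilde p d ^ 2 * b := fun i =>
    calc ‖e i‖ ^ 2 ≤ (dTilde p d * lpNorm p (e i)) ^ 2 :=
          pow_le_pow_left₀ (norm_nonneg _) (norm_le_dTilde_mul hp (e i)) 2
      _ ≤ dTilde p d ^ 2 * b := by
          rw [mul_pow]
          exact mul_le_mul_of_nonneg_left (he i) (sq_nonneg _)
  simpa [mul_assoc] using Finset.sum_le_card_nsmul Finset.univ _ _ fun i _ => hterm i

end Compression

section Run

variable {n d : ℕ} {p : ℝ≥0∞} {c : Params} {A : Matrix (Fin n) (Fin n) ℝ} {lam α : ℝ}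
  {f : Fin n → Vec d → ℝ} {flow : ℝ}

namespace IsProblem

variable (P : IsProblem c A lam f)
include P

lemma le_lyapunov (flow : ℝ) (x v : Fin n → Vec d) :
    c.eps1 * (‖matOp (matE n) (WithLp.toLp 2 x)‖ ^ 2
        + ⟪dualError c f x v, matOp (matF A lam) (dualError c f x v)⟫_ℝ)
      + n * (globalCost f (mean x) - flow) ≤ c.lyapunov A lam f flow x v := by
  rw [lyapunov_eq P.admissible.gam_pos.ne']
  exact add_le_add_left (P.triple.le_energy P.admissible.tau1_pos _ _) _

lemma card_mul_gap_le_lyapunov (flow : ℝ) (x v : Fin n → Vec d) :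
    n * (globalCost f (mean x) - flow) ≤ c.lyapunov A lam f flow x v := by
  have hquad := mul_nonneg P.admissible.eps1_pos.le
    (add_nonneg (sq_nonneg ‖matOp (matE n) (WithLp.toLp 2 x)‖)
      (P.triple.inner_inv_nonneg (dualError c f x v)))
  linarith [P.le_lyapunov flow x v]

lemma quadratic_le_lyapunov (hflow : ∀ x, flow ≤ globalCost f x) (x v : Fin n → Vec d) :
    (c.beta ^ 2 * c.rho ^ 2 + c.ell ^ 2) * ‖matOp (matE n) (WithLp.toLp 2 x)‖ ^ 2
        + c.gam ^ 2 * c.rho * ⟪dualError c f x v, matOp (matF A lam) (dualError c f x v)⟫_ℝ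
      ≤ max (c.beta ^ 2 * c.rho ^ 2 + c.ell ^ 2) (c.gam ^ 2 * c.rho) / c.eps1
        * c.lyapunov A lam f flow x v := by
  have heps1 := P.admissible.eps1_pos
  set X := ‖matOp (matE n) (WithLp.toLp 2 x)‖ ^ 2
  set W := ⟪dualError c f x v, matOp (matF A lam) (dualError c f x v)⟫_ℝ
  set m := max (c.beta ^ 2 * c.rho ^ 2 + c.ell ^ 2) (c.gam ^ 2 * c.rho)
  have hW : 0 ≤ W := P.triple.inner_inv_nonneg _
  have : 0 ≤ m := le_max_of_le_left (by positivity)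
  have hgap : 0 ≤ n * (globalCost f (mean x) - flow) :=
    mul_nonneg n.cast_nonneg (sub_nonneg.2 (hflow _))
  calc (c.beta ^ 2 * c.rho ^ 2 + c.ell ^ 2) * X + c.gam ^ 2 * c.rho * W
      ≤ m * X + m * W := by
        gcongr
        · exact le_max_left _ _
        · exact le_max_right _ _
    _ = m / c.eps1 * (c.eps1 * (X + W)) := by field_simp
    _ ≤ m / c.eps1 * c.lyapunov A lam f flow x v := by
        gcongr
        linarith [P.le_lyapunov flow x v]

lemma norm_advance_sub_sq_le (z : State n d) (xhat : Fin n → Vec d) (i : Fin n) :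
    ‖(z.advance c A α f xhat).x i - z.x i‖ ^ 2
      ≤ α ^ 2 * (4 * ((c.beta ^ 2 * c.rho ^ 2 + c.ell ^ 2)
            * ‖matOp (matE n) (WithLp.toLp 2 z.x)‖ ^ 2
          + c.gam ^ 2 * c.rho
            * ⟪dualError c f z.x z.v, matOp (matF A lam) (dualError c f z.x z.v)⟫_ℝ
          + c.beta ^ 2 * c.rho ^ 2 * ∑ j, ‖z.x j - xhat j‖ ^ 2)) := by
  have hc := P.admissible
  have hdirection := P.triple.norm_direction_sq_le c.beta c.gam (WithLp.toLp 2 xhat)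
    (dualError c f z.x z.v) (norm_gradError_le hc.ell_pos.le P.lipschitz z.x)
  have herror : ‖(WithLp.toLp 2 z.x - WithLp.toLp 2 xhat : Stacked n d)‖ ^ 2
      = ∑ j, ‖z.x j - xhat j‖ ^ 2 := PiLp.norm_sq_eq_of_L2 _ _
  have hcoord := PiLp.norm_apply_le
    (WithLp.toLp 2 (z.advance c A α f xhat).x - WithLp.toLp 2 z.x) i
  refine (pow_le_pow_left₀ (norm_nonneg _) hcoord 2).trans ?_
  rw [toLp_advance_x hc.gam_pos.ne' lam, sub_sub_cancel_left, norm_neg, norm_smul, mul_pow,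
    Real.norm_eq_abs, sq_abs, ← herror]
  gcongr

lemma movement_le (hflow : ∀ x, flow ≤ globalCost f x) (z : State n d) (xhat : Fin n → Vec d)
    (i : Fin n) :
    (1 + c.eps5⁻¹) * c.dhat ^ 2 * ‖(z.advance c A α f xhat).x i - z.x i‖ ^ 2
      ≤ α ^ 2 * (c.psi4 * c.lyapunov A lam f flow z.x z.v
        + c.psi3 * ∑ j, ‖z.x j - xhat j‖ ^ 2) := by
  have heps5 := P.admissible.eps5_pos
  refine (mul_le_mul_of_nonneg_left ((P.norm_advance_sub_sq_le z xhat i).trans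
    (mul_le_mul_of_nonneg_left (mul_le_mul_of_nonneg_left (add_le_add_left
      (P.quadratic_le_lyapunov hflow z.x z.v) _) (by norm_num)) (sq_nonneg α)))
    (by positivity)).trans_eq ?_
  rw [Params.psi3, Params.psi4]
  ring

end IsProblem

/-- A bound on the contribution `α ψ₂ ∑ ‖x_i - x̂_i‖²` of the compression error to one iteration
of the Lyapunov function, valid while the scaling factors do not exceed `s0`. -/
def Params.errorBudget (c : Params) (n : ℕ) (dt s0 α : ℝ) : ℝ :=
  α * c.psi2 α * (n * dt ^ 2 * (c.C ^ 2 * s0 ^ 2 * (1 - 2 * c.eps5)))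

/-- Stepsizes and scaling factors for which the compressor keeps being applied inside its local
region up to time `T`. -/
structure IsScaling (c : Params) (n : ℕ) (dt V0 α : ℝ) (s : ℕ → ℝ) (T : ℕ) : Prop where
  stepsize_nonneg : 0 ≤ α
  stepsize_le : α ≤ c.kappa7
  psi3_mul_le : (1 - 2 * c.eps5) * c.psi3 * (α ^ 2 * (n * dt ^ 2)) ≤ c.eps8
  pos : ∀ k, 0 < s k
  sq_le : ∀ k ≤ T, s k ^ 2 ≤ s 0 ^ 2
  sq_succ_ge : ∀ k < T, c.C ^ 2 * (1 - c.eps8) * s k ^ 2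
    + α ^ 2 * c.psi4 * (V0 + T * c.errorBudget n dt (s 0) α) ≤ c.C ^ 2 * s (k + 1) ^ 2

/-- The induction hypothesis on a run at time `k`. -/
structure RunBound (p : ℝ≥0∞) (c : Params) (A : Matrix (Fin n) (Fin n) ℝ) (lam : ℝ)
    (f : Fin n → Vec d → ℝ) (flow V0 α : ℝ) (s : ℕ → ℝ) (z : ℕ → State n d) (k : ℕ) : Prop where
  mean_v : mean (z k).v = 0
  lyapunov_le : c.lyapunov A lam f flow (z k).x (z k).v
      + α * ∑ j ∈ Finset.range k, progress c f (z j).x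
    ≤ V0 + k * c.errorBudget n (dTilde p d) (s 0) α
  error_le : ∀ i, lpNorm p ((z k).x i - (z (k + 1)).xhat i) ^ 2
    ≤ c.C ^ 2 * s k ^ 2 * (1 - 2 * c.eps5)

lemma progress_nonneg (c : Params) (f : Fin n → Vec d → ℝ) (x : Fin n → Vec d) :
    0 ≤ progress c f x := by
  rw [progress]
  positivity

lemma Params.Admissible.errorBudget_nonneg (hc : c.Admissible) (hα : 0 ≤ α) (n : ℕ) (dt s0 : ℝ) :
    0 ≤ c.errorBudget n dt s0 α := by
  have := hc.psi2_nonneg hα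
  have := hc.one_sub_two_mul_eps5_nonneg
  rw [Params.errorBudget]
  positivity

variable {comp : Vec d → Vec d} {s : ℕ → ℝ} {x0 : Fin n → Vec d} {z : ℕ → State n d} {k T : ℕ}
  {V0 : ℝ}

namespace State

lemma step_eq_advance {z : State n d} (hy : z.y = applyMat (laplacian A) z.xhat) (s : ℝ) :
    z.step c A α f comp s = z.advance c A α f (z.step c A α f comp s).xhat := by
  have hy' : (fun i => z.y i + (c.om * s) • applyMat (laplacian A) (z.message comp s) i)
      = applyMat (laplacian A) (fun i => z.xhat i + (c.om * s) • z.message comp s i) := by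
    funext i
    simp only [hy, applyMat, smul_add, Finset.sum_add_distrib, Finset.smul_sum,
      smul_comm (c.om * s)]
  simp only [State.step, State.advance, hy']
  rfl

lemma sub_step_xhat (z : State n d) (s : ℝ) (i : Fin n) :
    z.x i - (z.step c A α f comp s).xhat i
      = (z.x i - z.xhat i) - (c.om * s) • comp ((1 / s) • (z.x i - z.xhat i)) :=
  (sub_sub _ _ _).symm

namespace IsRunWithExactFirstRound

variable (hz : IsRunWithExactFirstRound c A α f comp s x0 z)
include hz

lemma x_zero : (z 0).x = x0 := by
  rcases hz.1 with ⟨h0, -⟩ | ⟨h0, -⟩ <;> rw [h0] <;> rfl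

lemma v_zero : (z 0).v = 0 := by
  rcases hz.1 with ⟨h0, -⟩ | ⟨h0, -⟩ <;> rw [h0] <;> rfl

lemma succ_eq_advance (k : ℕ) : z (k + 1) = (z k).advance c A α f (z (k + 1)).xhat := by
  induction k with
  | zero =>
    rcases hz.1 with ⟨h0, h1⟩ | ⟨-, h1⟩
    · rw [zero_add, h1]
      exact step_eq_advance (by rw [h0]; rfl) _
    · rw [zero_add, h1]
      rfl
  | succ k ih =>
    rw [hz.2 (k + 1) k.succ_pos]
    exact step_eq_advance (by rw [ih]; rfl) _

lemma error_zero_le (hc : c.Admissible) (hp : 1 ≤ p)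
    (hcomp : LocallyBounded p c.C c.r c.del comp) (hs : 0 < s 0) (i : Fin n) :
    lpNorm p ((z 0).x i - (z 1).xhat i) ^ 2 ≤ c.C ^ 2 * s 0 ^ 2 * (1 - 2 * c.eps5) := by
  have hzero : lpNorm p (0 : Vec d) = 0 := by simpa using lpNorm_smul hp 0 (0 : Vec d)
  rcases hz.1 with ⟨h0, h1⟩ | ⟨h0, h1⟩
  · rw [h1, sub_step_xhat]
    refine lpNorm_sub_compress_sq_le hc hp hcomp hs ?_
    rw [h0, show (warmStart A x0).x i - (warmStart A x0).xhat i = 0 from sub_self _, hzero,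
      zero_pow two_ne_zero]
    positivity
  · have := hc.one_sub_two_mul_eps5_nonneg
    have hcold : (z 0).x i - (z 1).xhat i = 0 := by
      rw [h1, h0]
      exact sub_self (x0 i)
    rw [hcold, hzero, zero_pow two_ne_zero]
    positivity

end IsRunWithExactFirstRound
end State

namespace RunBound

lemma zero (hc : c.Admissible) (hp : 1 ≤ p) (hcomp : LocallyBounded p c.C c.r c.del comp)
    (hs : 0 < s 0) (hz : State.IsRunWithExactFirstRound c A α f comp s x0 z) :
    RunBound p c A lam f flow (c.lyapunov A lam f flow x0 0) α s z 0 where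
  mean_v := by simp [hz.v_zero, mean]
  lyapunov_le := by simp [hz.x_zero, hz.v_zero]
  error_le := hz.error_zero_le hc hp hcomp hs

section Consequences

variable (B : RunBound p c A lam f flow V0 α s z k)
  (hS : IsScaling c n (dTilde p d) V0 α s T) (hk : k ≤ T)
include B hS hk

lemma lyapunov_add_progress_le (hc : c.Admissible) :
    c.lyapunov A lam f flow (z k).x (z k).v + α * ∑ j ∈ Finset.range k, progress c f (z j).x
      ≤ V0 + T * c.errorBudget n (dTilde p d) (s 0) α := by
  have := hc.errorBudget_nonneg hS.stepsize_nonneg n (dTilde p d) (s 0)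
  refine B.lyapunov_le.trans ?_
  gcongr

lemma lyapunov_le_budget (hc : c.Admissible) :
    c.lyapunov A lam f flow (z k).x (z k).v
      ≤ V0 + T * c.errorBudget n (dTilde p d) (s 0) α := by
  have hsum := mul_nonneg hS.stepsize_nonneg (Finset.sum_nonneg
    fun j (_ : j ∈ Finset.range k) => progress_nonneg c f (z j).x)
  linarith [B.lyapunov_add_progress_le hS hk hc]

lemma error_contribution_le (hc : c.Admissible) (hp : 1 ≤ p) :
    α * c.psi2 α * ∑ i, ‖(z k).x i - (z (k + 1)).xhat i‖ ^ 2
      ≤ c.errorBudget n (dTilde p d) (s 0) α := by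
  have hpsi2 := hc.psi2_nonneg hS.stepsize_nonneg
  have hα := hS.stepsize_nonneg
  have hS5 := hc.one_sub_two_mul_eps5_nonneg
  refine mul_le_mul_of_nonneg_left
    ((sum_norm_sq_le_of_lpNorm_sq_le hp B.error_le).trans ?_) (mul_nonneg hα hpsi2)
  have hsq := hS.sq_le k hk
  gcongr n * dTilde p d ^ 2 * (c.C ^ 2 * ?_ * (1 - 2 * c.eps5))

end Consequences

variable (B : RunBound p c A lam f flow V0 α s z k)
include B

lemma innovation_le (P : IsProblem c A lam f) (hp : 1 ≤ p) (hd : c.dhat = dHat p d)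
    (hflow : ∀ x, flow ≤ globalCost f x) (hS : IsScaling c n (dTilde p d) V0 α s T)
    (hz : State.IsRunWithExactFirstRound c A α f comp s x0 z) (hk : k < T) (i : Fin n) :
    lpNorm p ((z (k + 1)).x i - (z (k + 1)).xhat i) ^ 2 ≤ c.C ^ 2 * s (k + 1) ^ 2 := by
  have hc := P.admissible
  have hmovement := P.movement_le (α := α) hflow (z k) (z (k + 1)).xhat i
  rw [← hz.succ_eq_advance k, hd] at hmovement
  have hyoung := lpNorm_add_sq_le hp hc.eps5_pos ((z (k + 1)).x i - (z k).x i)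
    ((z k).x i - (z (k + 1)).xhat i)
  rw [sub_add_sub_cancel] at hyoung
  have hlyapunov := mul_le_mul_of_nonneg_left (B.lyapunov_le_budget hS hk.le hc)
    (mul_nonneg (sq_nonneg α) hc.psi4_pos.le)
  have hsum := mul_le_mul_of_nonneg_left (sum_norm_sq_le_of_lpNorm_sq_le hp B.error_le)
    (mul_nonneg (sq_nonneg α) hc.psi3_nonneg)
  have hpsi3 := mul_le_mul_of_nonneg_left hS.psi3_mul_le
    (by positivity : 0 ≤ c.C ^ 2 * s k ^ 2)
  have hcontract : (1 + c.eps5) * lpNorm p ((z k).x i - (z (k + 1)).xhat i) ^ 2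
      ≤ c.C ^ 2 * s k ^ 2 * (1 - 2 * c.eps8) :=
    calc _ ≤ (1 + c.eps5) * (c.C ^ 2 * s k ^ 2 * (1 - 2 * c.eps5)) := by
          have := hc.eps5_pos
          gcongr
          exact B.error_le i
      _ = c.C ^ 2 * s k ^ 2 * (1 - 2 * c.eps8) := by
          rw [Params.eps8]
          ring
  linarith [hS.sq_succ_ge k hk]

lemma succ (P : IsProblem c A lam f) (hp : 1 ≤ p) (hd : c.dhat = dHat p d)
    (hcomp : LocallyBounded p c.C c.r c.del comp) (hflow : ∀ x, flow ≤ globalCost f x)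
    (hS : IsScaling c n (dTilde p d) V0 α s T)
    (hz : State.IsRunWithExactFirstRound c A α f comp s x0 z) (hk : k < T) :
    RunBound p c A lam f flow V0 α s z (k + 1) where
  mean_v := by
    rw [hz.succ_eq_advance k]
    exact mean_advance_v P.network.symm B.mean_v
  lyapunov_le := by
    have hstep := P.lyapunov_advance_le (xhat := (z (k + 1)).xhat) hS.stepsize_nonneg
      hS.stepsize_le B.mean_v flow
    rw [← hz.succ_eq_advance k] at hstep
    rw [Finset.sum_range_succ]
    push_cast
    linarith [B.lyapunov_le, B.error_contribution_le hS hk.le P.admissible hp]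
  error_le i := by
    have hinnovation := B.innovation_le P hp hd hflow hS hz hk i
    rw [hz.2 (k + 1) k.succ_pos, State.sub_step_xhat]
    exact lpNorm_sub_compress_sq_le P.admissible hp hcomp (hS.pos _) hinnovation

end RunBound

theorem IsProblem.runBound (P : IsProblem c A lam f) (hp : 1 ≤ p) (hd : c.dhat = dHat p d)
    (hcomp : LocallyBounded p c.C c.r c.del comp) (hflow : ∀ x, flow ≤ globalCost f x)
    (hS : IsScaling c n (dTilde p d) (c.lyapunov A lam f flow x0 0) α s T)
    (hz : State.IsRunWithExactFirstRound c A α f comp s x0 z) (hk : k ≤ T) :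
    RunBound p c A lam f flow (c.lyapunov A lam f flow x0 0) α s z k := by
  induction k with
  | zero => exact .zero P.admissible hp hcomp (hS.pos 0) hz
  | succ k ih => exact (ih (by lia)).succ P hp hd hcomp hflow hS hz hk

end Run

section Scaling

variable {n T : ℕ} {c : Params} {dt V0 s0 α : ℝ} {s : ℕ → ℝ}

namespace Params

/-- The value per agent below which the Lyapunov function stays. -/
def level (c : Params) : ℝ := c.C ^ 2 * c.eps8 * c.tau4 / c.psi4

/-- The weight with which `progress` controls the two terms of the convergence measure. -/
def progressWeight (c : Params) : ℝ := min (3 / 10) (c.ell ^ 2 / 20)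

/-- The constant `M` of the convergence rate. -/
def rateConst (c : Params) : ℝ := max 1 (max c.level (c.level / (c.progressWeight * c.tau0)))

lemma kappaTilde4_eq (hC : c.C ≠ 0) (n T : ℕ) (dt V0 s0 α : ℝ) :
    c.C ^ 2 * c.kappaTilde4 n dt V0 s0 α T
      = α ^ 2 * c.psi4 * (V0 + T * c.errorBudget n dt s0 α) := by
  rw [kappaTilde4, errorBudget]
  field_simp

namespace Admissible

variable (hc : c.Admissible)
include hc

lemma progressWeight_pos : 0 < c.progressWeight := by
  have := hc.ell_pos
  exact lt_min (by norm_num) (by positivity)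

lemma kappaTilde4_le (hn : 0 < n) (hα : α ^ 3 * (n * dt ^ 2 * T) = c.tau0 ^ 3)
    (htau0 : c.Tau0LeKappa0 α) (hV0 : c.kappa4 n V0 ≤ c.tau4)
    (hs0 : s0 ^ 2 = c.tau4 * n * α ^ 2) :
    c.kappaTilde4 n dt V0 s0 α T ≤ c.eps8 * s0 ^ 2 := by
  have hC := hc.C_pos
  have h8 := hc.eps8_pos
  have hinitial : c.psi4 * V0 * α ^ 2 / c.C ^ 2 ≤ c.eps8 / 2 * s0 ^ 2 := by
    rw [kappa4, div_le_iff₀ (by positivity)] at hV0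
    rw [hs0, div_le_iff₀ (by positivity)]
    linarith [mul_le_mul_of_nonneg_left hV0 (sq_nonneg α)]
  have herror : (1 - 2 * c.eps5) * c.psi2 α * c.psi4 * n * dt ^ 2 * s0 ^ 2 * α ^ 3 * T
      ≤ c.eps8 / 2 * s0 ^ 2 := by
    have hscaled := mul_le_mul_of_nonneg_right htau0 (sq_nonneg s0)
    rw [← hα] at hscaled
    linarith
  rw [kappaTilde4]
  linarith

lemma budget_le (hα : 0 < α) (hs0 : s0 ^ 2 = c.tau4 * n * α ^ 2)
    (hincrement : c.kappaTilde4 n dt V0 s0 α T ≤ c.eps8 * s0 ^ 2) :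
    V0 + T * c.errorBudget n dt s0 α ≤ n * c.level := by
  have h4 := hc.psi4_pos
  refine le_of_mul_le_mul_left ?_ (by positivity : 0 < α ^ 2 * c.psi4)
  calc α ^ 2 * c.psi4 * (V0 + T * c.errorBudget n dt s0 α)
      = c.C ^ 2 * c.kappaTilde4 n dt V0 s0 α T := (kappaTilde4_eq hc.C_pos.ne' ..).symm
    _ ≤ c.C ^ 2 * (c.eps8 * s0 ^ 2) := by gcongr
    _ = α ^ 2 * c.psi4 * (n * c.level) := by
        rw [hs0, level]
        field_simp

lemma scaling_sq_le {κ : ℝ} (hκ : κ ≤ c.eps8 * s 0 ^ 2)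
    (hrec : ∀ k, 1 ≤ k → k ≤ T → s k ^ 2 = (1 - c.eps8) * s (k - 1) ^ 2 + κ) {k : ℕ}
    (hk : k ≤ T) : s k ^ 2 ≤ s 0 ^ 2 := by
  induction k with
  | zero => rfl
  | succ k ih =>
    rw [hrec (k + 1) k.succ_pos hk, Nat.add_sub_cancel]
    linarith [mul_le_mul_of_nonneg_left (ih (by lia)) (sub_nonneg.2 hc.eps8_le_one)]

lemma isScaling (hn : 0 < n) (hdt : 0 < dt) (hT : c.kappa3 n dt < T)
    (hα : α = c.stepsize n dt T) (hs : ∀ k, 0 < s k)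
    (hincrement : c.kappaTilde4 n dt V0 (s 0) α T ≤ c.eps8 * s 0 ^ 2)
    (hrec : ∀ k, 1 ≤ k → k ≤ T →
      s k ^ 2 = (1 - c.eps8) * s (k - 1) ^ 2 + c.kappaTilde4 n dt V0 (s 0) α T) :
    IsScaling c n dt V0 α s T where
  stepsize_nonneg := hα ▸ (stepsize_pos hc.tau0_pos hn hdt (hc.horizon_pos hn hdt hT)).le
  stepsize_le := hα ▸ hc.stepsize_le_kappa7 hn hdt hT
  psi3_mul_le := hα ▸ hc.psi3_mul_stepsize_sq_le hn hdt hT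
  pos := hs
  sq_le _ hk := hc.scaling_sq_le hincrement hrec hk
  sq_succ_ge k hk := by
    rw [hrec (k + 1) k.succ_pos hk, Nat.add_sub_cancel, ← kappaTilde4_eq hc.C_pos.ne', mul_add,
      mul_assoc]

end Admissible
end Params
end Scaling

section Rate

variable {n d T : ℕ} {p : ℝ≥0∞} {c : Params} {A : Matrix (Fin n) (Fin n) ℝ} {lam α V0 flow : ℝ}
  {f : Fin n → Vec d → ℝ} {s : ℕ → ℝ} {z : ℕ → State n d}

lemma progressWeight_mul_le_progress (hn : 0 < n) (x : Fin n → Vec d) :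
    n * (c.progressWeight * (‖∇ (globalCost f) (mean x)‖ ^ 2
      + 1 / (n : ℝ) * ∑ i, ‖x i - mean x‖ ^ 2)) ≤ progress c f x := by
  calc _ = c.progressWeight * n * ‖∇ (globalCost f) (mean x)‖ ^ 2
        + c.progressWeight * ∑ i, ‖x i - mean x‖ ^ 2 := by field_simp
    _ ≤ progress c f x := by
        rw [progress]
        gcongr
        · exact min_le_left _ _
        · exact min_le_right _ _

namespace RunBound

variable (B : RunBound p c A lam f flow V0 α s z T) (P : IsProblem c A lam f)
  (hS : IsScaling c n (dTilde p d) V0 α s T)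
  (hlevel : V0 + T * c.errorBudget n (dTilde p d) (s 0) α ≤ n * c.level)
include B P hS hlevel

lemma gap_le_level : globalCost f (mean (z T).x) - flow ≤ c.level := by
  refine le_of_mul_le_mul_left ?_ (Nat.cast_pos.2 P.network.card_pos)
  exact ((P.card_mul_gap_le_lyapunov flow _ _).trans
    (B.lyapunov_le_budget hS le_rfl P.admissible)).trans hlevel

lemma sum_le_level (hflow : ∀ x, flow ≤ globalCost f x) :
    α * (c.progressWeight * ∑ k ∈ Finset.range T, (‖∇ (globalCost f) (mean (z k).x)‖ ^ 2
      + 1 / (n : ℝ) * ∑ i, ‖(z k).x i - mean (z k).x‖ ^ 2)) ≤ c.level := by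
  have hn := P.network.card_pos
  have hα := hS.stepsize_nonneg
  have hlyapunov : 0 ≤ c.lyapunov A lam f flow (z T).x (z T).v :=
    (mul_nonneg n.cast_nonneg (sub_nonneg.2 (hflow _))).trans
      (P.card_mul_gap_le_lyapunov flow _ _)
  refine le_of_mul_le_mul_left ?_ (Nat.cast_pos.2 hn)
  calc _ = α * ∑ k ∈ Finset.range T, n * (c.progressWeight
          * (‖∇ (globalCost f) (mean (z k).x)‖ ^ 2
            + 1 / (n : ℝ) * ∑ i, ‖(z k).x i - mean (z k).x‖ ^ 2)) := by
        rw [← Finset.mul_sum, ← Finset.mul_sum]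
        ring
    _ ≤ α * ∑ k ∈ Finset.range T, progress c f (z k).x := by
        gcongr with k
        exact progressWeight_mul_le_progress hn _
    _ ≤ n * c.level := by
        linarith [B.lyapunov_add_progress_le hS le_rfl P.admissible]

theorem average_le_rate (hflow : ∀ x, flow ≤ globalCost f x) (hd : 0 < d) (hT : 0 < T)
    (hα : α = c.stepsize n (dTilde p d) T) :
    1 / (T : ℝ) * ∑ k ∈ Finset.range T, (‖∇ (globalCost f) (mean (z k).x)‖ ^ 2
        + 1 / (n : ℝ) * ∑ i, ‖(z k).x i - mean (z k).x‖ ^ 2)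
      ≤ c.rateConst * rate n (dTilde p d) T := by
  have hn := P.network.card_pos
  have hdt : 0 < dTilde p d := dTilde_pos hd
  have hrate := rate_pos hn hdt hT
  have hweight := P.admissible.progressWeight_pos
  have hαpos : 0 < α := hα ▸ Params.stepsize_pos P.admissible.tau0_pos hn hdt hT
  have hτ : α * T * rate n (dTilde p d) T = c.tau0 := hα ▸ Params.stepsize_mul_mul_rate hn hdt hT
  have hsum := B.sum_le_level P hS hlevel hflow
  calc _ ≤ 1 / (T : ℝ) * (c.level / (α * c.progressWeight)) := by
        gcongr
        rw [le_div_iff₀ (by positivity)]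
        linarith
    _ = c.level / (c.progressWeight * c.tau0) * rate n (dTilde p d) T := by
        rw [← hτ]
        field_simp
    _ ≤ c.rateConst * rate n (dTilde p d) T := by
        gcongr
        exact (le_max_right _ _).trans (le_max_right _ _)

end RunBound
end Rate

end CompressedOpt

end

open CompressedOpt in
theorem theorem2_general
    (c : Params)
    (hell : 0 < c.ell) (hC : 0 < c.C) (hr : 0 < c.r) (hdel : 0 < c.del) (hdel1 : c.del ≤ 1)
    (hom : 0 < c.om) (hom1 : c.om ≤ 1 / c.r)
    (hkappa : 0 < c.kappaHat0) (htau0 : 0 < c.tau0) :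
    ∃ M : ℝ, 0 < M ∧
      ∀ (n d : ℕ) (_ : 1 ≤ d) (p : ENNReal) (_ : 1 ≤ p) (_ : c.dhat = dHat p d)
        (A : Matrix (Fin n) (Fin n) ℝ) (_ : IsConnectedNetwork A)
        (_ : IsGreatest ((fun μ : ℝ => |μ|) '' spectrum ℝ (laplacian A)) c.rho)
        (_ : IsLeast {μ : ℝ | μ ∈ spectrum ℝ (laplacian A) ∧ 0 < μ} c.rho2)
        (lam : ℝ) (_ : c.rho2 ≤ lam) (_ : lam ≤ c.rho)
        (comp : Vec d → Vec d) (_ : LocallyBounded p c.C c.r c.del comp)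
        (f : Fin n → Vec d → ℝ) (_ : ∀ i, Differentiable ℝ (f i))
        (_ : ∀ i x y, ‖gradient (f i) x - gradient (f i) y‖ ≤ c.ell * ‖x - y‖)
        (_ : BddBelow (Set.range (globalCost f)))
        (flow : ℝ) (_ : flow ≤ ⨅ x, globalCost f x)
        (x0 : Fin n → Vec d) (T : ℕ) (_ : c.kappa3 n (dTilde p d) < T)
        (α : ℝ) (_ : α = c.stepsize n (dTilde p d) T) (_ : c.Tau0LeKappa0 α)
        (V0 : ℝ) (_ : V0 = c.lyapunov A lam f flow x0 0) (_ : c.kappa4 n V0 ≤ c.tau4)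
        (s : ℕ → ℝ) (_ : ∀ k, 0 < s k) (_ : s 0 ^ 2 = c.tau4 * n * α ^ 2)
        (_ : ∀ k, 1 ≤ k → k ≤ T →
          s k ^ 2 = (1 - c.eps8) * s (k - 1) ^ 2
            + c.kappaTilde4 n (dTilde p d) V0 (s 0) α T)
        (z : ℕ → State n d) (_ : State.IsRunWithExactFirstRound c A α f comp s x0 z),
        (1 / (T : ℝ)) * ∑ k ∈ Finset.range T,
            (‖gradient (globalCost f) (mean (z k).x)‖ ^ 2
              + (1 / (n : ℝ)) * ∑ i, ‖(z k).x i - mean (z k).x‖ ^ 2)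
          ≤ M * ((n : ℝ) ^ (1 / 3 : ℝ) * dTilde p d ^ (2 / 3 : ℝ) / (T : ℝ) ^ (2 / 3 : ℝ)) ∧
        globalCost f (mean (z T).x) - ⨅ x, globalCost f x ≤ M := by
  refine ⟨c.rateConst, zero_lt_one.trans_le (le_max_left _ _), ?_⟩
  intro n d hd p hp hdhat A hA hrho hrho2 lam hlam hlam' comp hcomp f hf hlip hbdd flow hflow x0 T
    hT α hα hκ0 V0 hV0 hκ4 s hs hs0 hrec z hz
  subst hV0
  have hc : c.Admissible := ⟨hell, hC, hr, hdel, hdel1, hom, (le_div_iff₀ hr).1 hom1, hrho2.1.2,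
    hlam.trans hlam', hdhat ▸ dHat_pos hd, hkappa, htau0⟩
  have P : IsProblem c A lam f :=
    ⟨hc, hA, hA.isNetworkTriple hrho hrho2 ⟨hlam, hlam'⟩, hf, hlip⟩
  have hn := hA.card_pos
  have hdt : 0 < dTilde p d := dTilde_pos hd
  have hT0 := hc.horizon_pos hn hdt hT
  have hα3 := hα ▸ Params.stepsize_pow_three_mul (c := c) hn hdt hT0
  have hincrement := hc.kappaTilde4_le hn hα3 hκ0 hκ4 hs0
  have hS := hc.isScaling hn hdt hT hα hs hincrement hrec
  have hlevel := hc.budget_le (hα ▸ Params.stepsize_pos htau0 hn hdt hT0) hs0 hincrement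
  have hflow' : ∀ x, flow ≤ globalCost f x := fun x => hflow.trans (ciInf_le hbdd x)
  have B := P.runBound hp hdhat hcomp hflow' hS hz le_rfl
  refine ⟨B.average_le_rate P hS hlevel hflow' hd hT0 hα, ?_⟩
  calc _ ≤ globalCost f (mean (z T).x) - flow := sub_le_sub_left hflow _
    _ ≤ c.level := B.gap_le_level P hS hlevel
    _ ≤ c.rateConst := (le_max_left _ _).trans (le_max_right _ _)

open CompressedOpt in
theorem theorem2
    -- the hidden constant `M` depends on these scalars only
    (c : Params)
    (hell : 0 < c.ell) (hC : 0 < c.C) (hr : 0 < c.r) (hdel : 0 < c.del) (hdel1 : c.del ≤ 1)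
    (hom : 0 < c.om) (hom1 : c.om ≤ 1 / c.r)
    (htau1 : c.kappa1 ≤ c.tau1) (hgam : c.kappa2 < c.gam) (hkappa : 0 < c.kappaHat0)
    (htau0 : 0 < c.tau0) (htau4 : 0 < c.tau4) :
    ∃ M : ℝ, 0 < M ∧
      ∀ (n d : ℕ) (_ : 1 ≤ d) (p : ENNReal) (_ : 1 ≤ p) (_ : c.dhat = dHat p d)
        -- the network, its spectrum, and the eigenvalue chosen in the definition of `F`
        (A : Matrix (Fin n) (Fin n) ℝ) (_ : IsConnectedNetwork A)
        (_ : IsGreatest ((fun μ : ℝ => |μ|) '' spectrum ℝ (laplacian A)) c.rho)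
        (_ : IsLeast {μ : ℝ | μ ∈ spectrum ℝ (laplacian A) ∧ 0 < μ} c.rho2)
        (lam : ℝ) (_ : c.rho2 ≤ lam) (_ : lam ≤ c.rho)
        -- the compressor
        (comp : Vec d → Vec d) (_ : LocallyBounded p c.C c.r c.del comp)
        -- the cost functions and the known lower bound
        (f : Fin n → Vec d → ℝ) (_ : ∀ i, Differentiable ℝ (f i))
        (_ : ∀ i x y, ‖gradient (f i) x - gradient (f i) y‖ ≤ c.ell * ‖x - y‖)
        (_ : BddBelow (Set.range (globalCost f)))
        (flow : ℝ) (_ : flow ≤ ⨅ x, globalCost f x)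
        -- initial point, horizon, stepsize and scaling factors
        (x0 : Fin n → Vec d) (T : ℕ) (_ : c.kappa3 n (dTilde p d) < T)
        (α : ℝ) (_ : α = c.stepsize n (dTilde p d) T) (_ : c.Tau0LeKappa0 α)
        (V0 : ℝ) (_ : V0 = c.lyapunov A lam f flow x0 0) (_ : c.kappa4 n V0 ≤ c.tau4)
        (s : ℕ → ℝ) (_ : ∀ k, 0 < s k) (_ : s 0 ^ 2 = c.tau4 * n * α ^ 2)
        (_ : ∀ k, 1 ≤ k → k ≤ T →
          s k ^ 2 = (1 - c.eps8) * s (k - 1) ^ 2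
            + c.kappaTilde4 n (dTilde p d) V0 (s 0) α T)
        -- the run of the algorithm
        (z : ℕ → State n d) (_ : State.IsRunWithExactFirstRound c A α f comp s x0 z),
        (1 / (T : ℝ)) * ∑ k ∈ Finset.range T,
            (‖gradient (globalCost f) (mean (z k).x)‖ ^ 2
              + (1 / (n : ℝ)) * ∑ i, ‖(z k).x i - mean (z k).x‖ ^ 2)
          ≤ M * ((n : ℝ) ^ (1 / 3 : ℝ) * dTilde p d ^ (2 / 3 : ℝ) / (T : ℝ) ^ (2 / 3 : ℝ)) ∧
        globalCost f (mean (z T).x) - ⨅ x, globalCost f x ≤ M :=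
  theorem2_general c hell hC hr hdel hdel1 hom hom1 hkappa htau0
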